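/- **Theorem 2.5.** Let $r\ge 1$ and $\hat\ell\ge 2$ be integers and let $B\in\mathbb{R}$. There is a constant $K=K(r,\hat\ell,B)$ such that the following holds for every $n\ge 2$. Let $\{Y_{jk}\}_{1\le j\le k\le n}$ and $\{\tilde Y_{jk}\}_{1\le j\le k\le n}$ be two families of real random variables (possibly on different probability spaces), each jointly Gaussian with mean $0$ (the covariance matrix may be singular). Write $Y_{kj}=Y_{jk}$, $\tilde Y_{kj}=\tilde Y_{jk}$, $\sigma_{jk,uv}=\operatorname{Cov}(Y_{jk},Y_{uv})$, $\tilde\sigma_{jk,uv}=\operatorname{Cov}(\tilde Y_{jk},\tilde Y_{uv})$. Suppose that $|\sigma_{jk,uv}|$ and $|\tilde\sigma_{jk,uv}|$ are at most $B$ if $\{j,k\}\cap\{u,v\}\ne\emptyset$ and at most $B/n$ if $\{j,k\}\cap\{u,v\}=\emptyset$. Let $$Y=\sum_{j=1}^n c^{(1)}_{jj}Y_{jj}+\sum_{1\le j\le k\le n}c^{(2)}_{jk}Y_{jk}^2+\sum_{\ell=3}^{\hat\ell}\sum_{1\le j<k\le n}c^{(\ell)}_{jk}Y_{jk}^\ell,$$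 and let $\tilde Y$ be defined in the same way from the variables $\tilde Y_{jk}$ and coefficients $\tilde c^{(\ell)}_{jk}$, where all coefficients are complex. Suppose that there are real numbers $C_1,\ldots,C_{\hat\ell}$ such that $$|c^{(1)}_{jj}|\le nC_1,\qquad |c^{(2)}_{jj}|\le nC_2\qquad(1\le j\le n),$$ $$|c^{(\ell)}_{jk}|\le C_\ell\qquad(1\le j<k\le n,\ 2\le\ell\le\hat\ell),$$ and that the coefficients $\tilde c^{(\ell)}_{jk}$ satisfy the same bounds. Suppose that there is a real number $\mu$ such that, for all $1\le j_1,k_1,j_2,k_2\le n$, $$\frac1{n!}\sum_{g\in S_n}\bigl|\sigma_{g(j_1)g(k_1),g(j_2)g(k_2)}-\tilde\sigma_{g(j_1)g(k_1),g(j_2)g(k_2)}\bigr|\le\begin{cases}\mu,&\{j_1,k_1\}\cap\{j_2,k_2\}\ne\emptyset,\\ \mu/n,&\text{otherwise,}\end{cases}$$ and real numbers $\mu_1,\mu'_1,\mu_2,\ldots,\mu_{\hat\ell}$ such that $$\sum_{j=1}^n|c^{(1)}_{jj}-\tilde c^{(1)}_{jj}|\le\mu_1n^2C_1,$$ $$|c^{(1)}_{jj}-\tilde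 c^{(1)}_{jj}|\sum_{i=1}^n\bigl(|c^{(1)}_{ii}|+|\tilde c^{(1)}_{ii}|\bigr)\le\mu'_1n^3C_1^2\qquad(1\le j\le n),$$ $$\sum_{j=1}^n|c^{(2)}_{jj}-\tilde c^{(2)}_{jj}|\le\mu_2n^2C_2,$$ $$\sum_{1\le j<k\le n}|c^{(\ell)}_{jk}-\tilde c^{(\ell)}_{jk}|\le\mu_\ell n^2C_\ell\qquad(2\le\ell\le\hat\ell).$$ Then the $r$-th cumulants satisfy $$|\kappa_r(Y)-\kappa_r(\tilde Y)|\le K\,n^{r+1}\max_{\ell_1,\ldots,\ell_r}\biggl(C_{\ell_1}\cdots C_{\ell_r}\Bigl(\mu+\sum_{j\in\{\ell_1,\ldots,\ell_r\}}\mu_j\Bigr)\biggr),$$ where the maximum is over all $(\ell_1,\ldots,\ell_r)$ with $1\le\ell_1,\ldots,\ell_r\le\hat\ell$ and $\ell_1+\cdots+\ell_r$ even, and $\{\ell_1,\ldots,\ell_r\}$ is the set of distinct values. Moreover, with the same $K$, the bound remains true if, for any chosen collection of tuples $(\ell_1,\ldots,\ell_r)$ in each of which at least two entries equal $1$, the summand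 $\mu_1$ is replaced by $\mu'_1$. Here $\kappa_r(Z)=\sum_\pi(-1)^{|\pi|-1}(|\pi|-1)!\prod_{A\in\pi}\mathbb{E}\,Z^{|A|}$, the sum being over all set partitions $\pi$ of $\{1,\ldots,r\}$. -/

import Mathlib

open MeasureTheory ProbabilityTheory

namespace CumDiff

noncomputable section

/-- The joint (mixed) cumulant of complex random variables `Z₁, …, Z_r`: the sum over all
set partitions `π` of the index set of
`(-1)^(|π|-1) (|π|-1)! ∏_{B ∈ π} 𝔼 ∏_{i ∈ B} Z_i`. It is used only for `r ≥ 1`. -/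
def jointCumulant {Ω : Type*} [MeasurableSpace Ω] (P : Measure Ω) {r : ℕ}
    (Z : Fin r → Ω → ℂ) : ℂ :=
  ∑ π : Finpartition (Finset.univ : Finset (Fin r)),
    (-1 : ℂ) ^ (π.parts.card - 1) * ((π.parts.card - 1).factorial : ℂ) *
      ∏ B ∈ π.parts, ∫ ω, ∏ i ∈ B, Z i ω ∂P

/-- The `r`-th cumulant `κ_r(Z) = κ(Z, …, Z)`. -/
def cumulant {Ω : Type*} [MeasurableSpace Ω] (P : Measure Ω) (r : ℕ) (Z : Ω → ℂ) : ℂ :=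
  jointCumulant P (fun _ : Fin r => Z)

/-- The unordered pairs `e = {j,k}` and `f = {u,v}` (with `j = k`, `u = v` allowed) intersect. -/
def Meets {n : ℕ} (e f : Sym2 (Fin n)) : Prop := ∃ v, v ∈ e ∧ v ∈ f

/-- A centred jointly Gaussian family `(Y_{jk})_{1 ≤ j ≤ k ≤ n}`, indexed by unordered pairs with
repetition, so that `Y_{jk} = Y_{kj}`. The covariances are at most `B` in absolute value, and at
most `B / n` for disjoint index pairs. The joint law is allowed to be degenerate. -/
structure IsGaussianFamily {n : ℕ} {Ω : Type*} [MeasurableSpace Ω] (P : Measure Ω) (B : ℝ)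
    (Y : Sym2 (Fin n) → Ω → ℝ) : Prop where
  gaussian : HasGaussianLaw (fun ω e => Y e ω) P
  mean_zero : ∀ e, ∫ ω, Y e ω ∂P = 0
  cov_meets : ∀ e f, Meets e f → |cov[Y e, Y f; P]| ≤ B
  cov_disjoint : ∀ e f, ¬ Meets e f → |cov[Y e, Y f; P]| ≤ B / n

/-- The bounds `|c⁽¹⁾_{jj}| ≤ n C₁`, `|c⁽²⁾_{jj}| ≤ n C₂`, `|c⁽²⁾_{jk}| ≤ C₂` for `j < k`, and
`|c⁽ℓ⁾_{jk}| ≤ C_ℓ` for `j < k`, `3 ≤ ℓ ≤ L`. -/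
structure CoeffBounds {n : ℕ} (L : ℕ) (C : ℕ → ℝ) (c : ℕ → Sym2 (Fin n) → ℂ) : Prop where
  linear : ∀ j : Fin n, ‖c 1 s(j, j)‖ ≤ n * C 1
  quadratic_diag : ∀ j : Fin n, ‖c 2 s(j, j)‖ ≤ n * C 2
  quadratic_offDiag : ∀ j k : Fin n, j < k → ‖c 2 s(j, k)‖ ≤ C 2
  higher : ∀ ℓ, 3 ≤ ℓ → ℓ ≤ L → ∀ j k : Fin n, j < k → ‖c ℓ s(j, k)‖ ≤ C ℓ

/-- The random variable
`∑_j c⁽¹⁾_{jj} Y_{jj} + ∑_{j ≤ k} c⁽²⁾_{jk} Y_{jk}² + ∑_{3 ≤ ℓ ≤ L} ∑_{j < k} c⁽ℓ⁾_{jk} Y_{jk}^ℓ`.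
The sums over pairs with `j ≤ k`, respectively `j < k`, are sums over all unordered pairs with
repetition, respectively over those that are not on the diagonal. -/
def polyFunctional {n : ℕ} {Ω : Type*} (L : ℕ) (c : ℕ → Sym2 (Fin n) → ℂ)
    (Y : Sym2 (Fin n) → Ω → ℝ) : Ω → ℂ := fun ω =>
  (∑ j : Fin n, c 1 s(j, j) * (Y s(j, j) ω : ℂ))
    + (∑ e : Sym2 (Fin n), c 2 e * (Y e ω : ℂ) ^ 2)
    + ∑ ℓ ∈ Finset.Icc 3 L, ∑ e : Sym2 (Fin n) with ¬ e.IsDiag, c ℓ e * (Y e ω : ℂ) ^ ℓ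

/-- The average over all permutations `g` of the absolute covariance difference
`|σ_{g(j)g(k),g(u)g(v)} - σ'_{g(j)g(k),g(u)g(v)}|` is at most `μ` for intersecting pairs, and at
most `μ / n` for disjoint ones. -/
def CovDiffBound {n : ℕ} (μ : ℝ) (σ σ' : Sym2 (Fin n) → Sym2 (Fin n) → ℝ) : Prop :=
  ∀ e f : Sym2 (Fin n),
    (Meets e f →
      (n.factorial : ℝ)⁻¹ * ∑ g : Equiv.Perm (Fin n),
        |σ (e.map g) (f.map g) - σ' (e.map g) (f.map g)| ≤ μ) ∧
    (¬ Meets e f →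
      (n.factorial : ℝ)⁻¹ * ∑ g : Equiv.Perm (Fin n),
        |σ (e.map g) (f.map g) - σ' (e.map g) (f.map g)| ≤ μ / n)

/-- The summed bounds on the differences of the coefficients. Here `m ℓ` is `μ_ℓ` and `m1'` is
`μ'₁`. -/
structure CoeffDiffBounds {n : ℕ} (L : ℕ) (C m : ℕ → ℝ) (m1' : ℝ)
    (c c' : ℕ → Sym2 (Fin n) → ℂ) : Prop where
  linear : ∑ j : Fin n, ‖c 1 s(j, j) - c' 1 s(j, j)‖ ≤ m 1 * (n : ℝ) ^ 2 * C 1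
  linear' : ∀ j : Fin n, ‖c 1 s(j, j) - c' 1 s(j, j)‖ *
    ∑ i : Fin n, (‖c 1 s(i, i)‖ + ‖c' 1 s(i, i)‖) ≤ m1' * (n : ℝ) ^ 3 * C 1 ^ 2
  quadratic_diag : ∑ j : Fin n, ‖c 2 s(j, j) - c' 2 s(j, j)‖ ≤ m 2 * (n : ℝ) ^ 2 * C 2
  offDiag : ∀ ℓ, 2 ≤ ℓ → ℓ ≤ L →
    ∑ e : Sym2 (Fin n) with ¬ e.IsDiag, ‖c ℓ e - c' ℓ e‖ ≤ m ℓ * (n : ℝ) ^ 2 * C ℓ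

/-- The tuples `(ℓ₁, …, ℓ_r)` with `1 ≤ ℓ_i ≤ L` and `ℓ₁ + ⋯ + ℓ_r` even. -/
def degreeTuples (r L : ℕ) : Finset (Fin r → ℕ) :=
  (Fintype.piFinset fun _ : Fin r => Finset.Icc 1 L).filter fun ℓ => Even (∑ i, ℓ i)

theorem degreeTuples_nonempty (r : ℕ) {L : ℕ} (hL : 2 ≤ L) : (degreeTuples r L).Nonempty := by
  refine ⟨fun _ => 2, ?_⟩
  simp only [degreeTuples, Finset.mem_filter, Fintype.mem_piFinset, Finset.mem_Icc]
  exact ⟨fun _ => ⟨by norm_num, hL⟩, by simp⟩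

/-- The quantity `C_{ℓ₁} ⋯ C_{ℓ_r} (μ + ∑_{j ∈ {ℓ₁, …, ℓ_r}} μ_j)`, the sum being over the set of
distinct values of the tuple. For the tuples in `S` the summand `μ₁` is replaced by `μ'₁`. -/
def boundTerm {r : ℕ} (C m : ℕ → ℝ) (m1' μ : ℝ) (S : Finset (Fin r → ℕ)) (ℓ : Fin r → ℕ) : ℝ :=
  (∏ i, C (ℓ i)) *
    (μ + ∑ j ∈ Finset.univ.image ℓ, if j = 1 ∧ ℓ ∈ S then m1' else m j)

end

end CumDiff

/-! The difference is estimated diagram by diagram. Cumulants are multilinear, so both expand into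
joint cumulants of powers of the Gaussian variables. By Wick's formula such a cumulant is a sum,
over the connected multigraphs `M` obtained by pairing `ℓ i` half-edges at each vertex `i`, of
products of covariances along the edges. Connectedness comes from a colouring argument: summing
products of moments of colour classes over all `N`-colourings of the vertices gives a polynomial in
`N` whose linear coefficient is the joint cumulant. On the Wick side a matching contributes `N` to
the number of its components, so exactly the connected ones survive
(`sum_finpartition_eq_sum_connectedDiagrams`).

For one diagram, the sum over labels `e i` of the vertices is bounded by a spanning tree argument
(`card_pow_mul_sum_le`). Give a pair weight `n` on the diagonal and `1` elsewhere, and an edge the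
kernel `1` or `1/n` according to whether its labels meet. Summing out a vertex joined to one already
fixed costs at most `6n`, and a root costs `O(n²)`, whence `n^(r+1)`.

For a difference, the product is telescoped so that each term contains a single difference of
coefficients or of covariances (`norm_diagram_sum_sub_le`). The tree is rooted at the vertex or edge
carrying that difference, where the summed hypotheses apply. The covariance hypothesis is only an
average over permutations, which suffices because the weights are permutation invariant
(`sum_mul_le_of_covDiffBound`). For `μ'₁` the difference is bounded by its maximum and the root is
moved to another linear vertex. -/

namespace CumDiff

/-! ### Moments of all orders. -/

/-- `f` has finite moments of all orders. -/
def HasAllMoments {Ω 𝕜 : Type*} [MeasurableSpace Ω] [NormedField 𝕜] (f : Ω → 𝕜) (P : Measure Ω) :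
    Prop := ∀ p : ENNReal, p ≠ ⊤ → MemLp f p P

namespace HasAllMoments

variable {Ω 𝕜 : Type*} [MeasurableSpace Ω] [NormedField 𝕜] {P : Measure Ω} {f g : Ω → 𝕜}

theorem add (hf : HasAllMoments f P) (hg : HasAllMoments g P) :
    HasAllMoments (fun x => f x + g x) P := fun p hp => (hf p hp).add (hg p hp)

theorem mul (hf : HasAllMoments f P) (hg : HasAllMoments g P) :
    HasAllMoments (fun x => f x * g x) P := fun p hp => by
  have : ENNReal.HolderTriple (p * 2) (p * 2) p := ⟨by
    rw [ENNReal.mul_inv (by simp) (by simp), ← mul_add, ENNReal.inv_two_add_inv_two, mul_one]⟩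
  have h2 : p * 2 ≠ ⊤ := ENNReal.mul_ne_top hp (by simp)
  exact MemLp.mul (hg _ h2) (hf _ h2)

theorem const [IsFiniteMeasure P] (c : 𝕜) : HasAllMoments (fun _ => c) P :=
  fun _ _ => memLp_const c

theorem prod [IsFiniteMeasure P] {β : Type*} {f : β → Ω → 𝕜} {S : Finset β}
    (h : ∀ i ∈ S, HasAllMoments (f i) P) : HasAllMoments (fun x => ∏ i ∈ S, f i x) P := by
  classical
  induction S using Finset.induction_on with
  | empty => simpa using const (P := P) (1 : 𝕜)
  | insert a S ha ih =>
    simp only [Finset.prod_insert ha]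
    exact (h a (by simp)).mul (ih fun i hi => h i (by simp [hi]))

theorem integrable (hf : HasAllMoments f P) : Integrable f P :=
  memLp_one_iff_integrable.1 (hf 1 (by simp))

end HasAllMoments

/-! ### Gaussian integration by parts. -/

section Stein

variable {ι : Type*} [Fintype ι] (ν : Measure (ι → ℝ)) [IsGaussian ν]

theorem hasAllMoments_eval (i : ι) : HasAllMoments (fun x : ι → ℝ => x i) ν := fun p hp =>
  (IsGaussian.memLp_id ν p hp).continuousLinearMap_comp (ContinuousLinearMap.proj (R := ℝ) i)

theorem hasAllMoments_fst (i : ι) :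
    HasAllMoments (fun z : (ι → ℝ) × (ι → ℝ) => z.1 i) (ν.prod ν) := fun p hp =>
  (hasAllMoments_eval ν i p hp).comp_fst ν

theorem hasAllMoments_snd (i : ι) :
    HasAllMoments (fun z : (ι → ℝ) × (ι → ℝ) => z.2 i) (ν.prod ν) := fun p hp =>
  (hasAllMoments_eval ν i p hp).comp_snd ν

/-- If the integral of a random polynomial vanishes at every point, then so do the integrals of
its coefficients. -/
theorem integral_coeff_eq_zero {Ω : Type*} [MeasurableSpace Ω] {P : Measure Ω}
    (p : Ω → Polynomial ℝ) (N : ℕ) (hN : ∀ ω, (p ω).natDegree < N)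
    (hint : ∀ k, Integrable (fun ω => (p ω).coeff k) P)
    (h0 : ∀ t : ℝ, ∫ ω, (p ω).eval t ∂P = 0) (k : ℕ) : ∫ ω, (p ω).coeff k ∂P = 0 := by
  set q : Polynomial ℝ :=
    ∑ j ∈ Finset.range N, Polynomial.monomial j (∫ ω, (p ω).coeff j ∂P) with hq
  have hq0 : q = 0 := by
    refine Polynomial.funext fun t => ?_
    rw [Polynomial.eval_zero, ← h0 t, hq, Polynomial.eval_finsetSum]
    simp_rw [Polynomial.eval_monomial, Polynomial.eval_eq_sum_range' (hN _)]
    rw [integral_finsetSum _ fun j _ => (hint j).mul_const _]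
    simp_rw [integral_mul_const]
  by_cases hk : k < N
  · have := congrArg (fun r => Polynomial.coeff r k) hq0
    simpa [hq, Polynomial.finsetSum_coeff, Polynomial.coeff_monomial, hk] using this
  · have : ∀ ω, (p ω).coeff k = 0 := fun ω =>
      Polynomial.coeff_eq_zero_of_natDegree_lt ((hN ω).trans_le (not_lt.1 hk))
    simp [this]

open Polynomial in
-- Supplies, by induction on the number of linear factors, the integrability needed to compare
-- coefficients under the integral.
theorem hasAllMoments_coeff_linear_mul {Ω : Type*} [MeasurableSpace Ω] {P : Measure Ω}
    {a b : Ω → ℝ} (ha : HasAllMoments a P) (hb : HasAllMoments b P) {q : Ω → ℝ[X]}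
    (hq : ∀ k, HasAllMoments (fun ω => (q ω).coeff k) P) (k : ℕ) :
    HasAllMoments (fun ω => ((C (a ω) + X * C (b ω)) * q ω).coeff k) P := by
  cases k with
  | zero => simpa [add_mul, mul_assoc] using ha.mul (hq 0)
  | succ k =>
    simpa [add_mul, mul_assoc, Polynomial.coeff_X_mul] using
      (ha.mul (hq (k + 1))).add (hb.mul (hq k))

open Polynomial in
/-- Gaussian integration by parts for products of coordinates of a centred Gaussian vector. -/
theorem integral_mul_prod_of_isGaussian (hν : ∫ x, x ∂ν = 0) {β : Type*} [DecidableEq β]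
    (S : Finset β) (e : β → ι) (a : ι) :
    ∫ x, x a * ∏ h ∈ S, x (e h) ∂ν =
      ∑ b ∈ S, (∫ x, x a * x (e b) ∂ν) * ∫ x, ∏ h ∈ S.erase b, x (e h) ∂ν := by
  -- Take two independent copies `x`, `y` and rotate them by the angle with tangent `t`. Up to a
  -- power of the cosine, `(p z).eval t` is the rotated value of `(∏ x (e h)) * y a`, which has mean
  -- zero. Rotation invariance makes the mean vanish for every `t`.
  set p : (ι → ℝ) × (ι → ℝ) → ℝ[X] := fun z =>
    (C (z.2 a) + X * C (-z.1 a)) * ∏ h ∈ S, (C (z.1 (e h)) + X * C (z.2 (e h))) with hp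
  have hmean (i : ι) : ∫ x, x i ∂ν = 0 := by
    have := IsGaussian.integral_dual (μ := ν) (ContinuousLinearMap.proj (R := ℝ) i)
    simpa [hν] using this
  have hdeg1 (x y : ℝ) : (C x + X * C y).natDegree ≤ 1 := by
    compute_degree
  have hdeg (z) : (p z).natDegree < S.card + 2 := by
    have h1 : (∏ h ∈ S, (C (z.1 (e h)) + X * C (z.2 (e h)))).natDegree ≤ S.card := by
      refine (Polynomial.natDegree_prod_le _ _).trans ?_
      refine (Finset.sum_le_sum fun h _ => hdeg1 _ _).trans ?_
      simp
    have h2 := Polynomial.natDegree_mul_le (p := C (z.2 a) + X * C (-z.1 a))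
      (q := ∏ h ∈ S, (C (z.1 (e h)) + X * C (z.2 (e h))))
    have h3 := hdeg1 (z.2 a) (-z.1 a)
    simp only [hp]
    omega
  have hneg : HasAllMoments (fun z : (ι → ℝ) × (ι → ℝ) => -z.1 a) (ν.prod ν) := fun q hq =>
    (hasAllMoments_fst ν a q hq).neg
  have hcoeff : ∀ k, HasAllMoments (fun z => (p z).coeff k) (ν.prod ν) := by
    refine hasAllMoments_coeff_linear_mul (hasAllMoments_snd ν a) hneg ?_
    clear hdeg hp p
    induction S using Finset.induction_on with
    | empty =>
      intro k
      simpa using HasAllMoments.const _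
    | insert b S hb ih =>
      simp only [Finset.prod_insert hb]
      exact hasAllMoments_coeff_linear_mul (hasAllMoments_fst ν _) (hasAllMoments_snd ν _) ih
  have heval (t : ℝ) : ∫ z, (p z).eval t ∂(ν.prod ν) = 0 := by
    set g : (ι → ℝ) × (ι → ℝ) → ℝ := fun z => (∏ h ∈ S, z.1 (e h)) * z.2 a with hg
    have hg0 : ∫ z, g z ∂(ν.prod ν) = 0 := by
      rw [hg, integral_prod_mul (fun x : ι → ℝ => ∏ h ∈ S, x (e h)) (fun x : ι → ℝ => x a), hmean,
        mul_zero]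
    have hrot := IsGaussian.map_rotation_eq_self (μ := ν) (by simpa using hν) (Real.arctan t)
    rw [← hrot, integral_map (by fun_prop) (by fun_prop)] at hg0
    have hc : 0 < Real.cos (Real.arctan t) := Real.cos_arctan_pos t
    have hs : Real.sin (Real.arctan t) = Real.cos (Real.arctan t) * t := by
      rw [← Real.tan_mul_cos hc.ne', Real.tan_arctan, mul_comm]
    have hgp (z) : g (ContinuousLinearMap.rotation (Real.arctan t) z) =
        Real.cos (Real.arctan t) ^ (S.card + 1) * (p z).eval t := by
      simp only [hg, hp, ContinuousLinearMap.rotation_apply, hs, Pi.add_apply, Pi.smul_apply,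
        smul_eq_mul, Polynomial.eval_mul, Polynomial.eval_prod, Polynomial.eval_add,
        Polynomial.eval_C, Polynomial.eval_X]
      have (h : β) : Real.cos (Real.arctan t) * z.1 (e h) + Real.cos (Real.arctan t) * t * z.2 (e h)
          = Real.cos (Real.arctan t) * (z.1 (e h) + t * z.2 (e h)) := by ring
      simp_rw [this, Finset.prod_mul_distrib, Finset.prod_const]
      ring
    simp_rw [hgp, integral_const_mul] at hg0
    exact (mul_eq_zero.1 hg0).resolve_left (by positivity)
  have key := integral_coeff_eq_zero p _ hdeg (fun k => (hcoeff k).integrable) heval 1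
  -- The linear coefficient in `t` is the integration by parts identity before taking expectations.
  -- The factor `1` is a function of the second copy, so that both terms split over the product
  -- measure.
  have hc1 (z) : (p z).coeff 1 = (∑ b ∈ S, (∏ h ∈ S.erase b, z.1 (e h)) * (z.2 a * z.2 (e b))) -
      (z.1 a * ∏ h ∈ S, z.1 (e h)) * 1 := by
    have : (p z).coeff 1 = (derivative (p z)).eval 0 := by
      rw [← Polynomial.coeff_zero_eq_eval_zero, Polynomial.coeff_derivative]; simp
    rw [this]
    simp only [hp, Polynomial.derivative_mul, Polynomial.derivative_prod_finset]
    simp [Polynomial.eval_prod, Polynomial.eval_finsetSum, Finset.mul_sum]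
    rw [sub_eq_neg_add]
    congr 1
    exact Finset.sum_congr rfl fun b _ => by ring
  have hprod (T : Finset β) : HasAllMoments (fun x : ι → ℝ => ∏ h ∈ T, x (e h)) ν :=
    HasAllMoments.prod fun i _ => hasAllMoments_eval ν _
  have hpair (b : β) : HasAllMoments (fun x : ι → ℝ => x a * x (e b)) ν :=
    (hasAllMoments_eval ν _).mul (hasAllMoments_eval ν _)
  have hi (b : β) : Integrable (fun z : (ι → ℝ) × (ι → ℝ) =>
      (∏ h ∈ S.erase b, z.1 (e h)) * (z.2 a * z.2 (e b))) (ν.prod ν) :=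
    (hprod (S.erase b)).integrable.mul_prod (hpair b).integrable
  have hi' : Integrable (fun z : (ι → ℝ) × (ι → ℝ) =>
      (z.1 a * ∏ h ∈ S, z.1 (e h)) * 1) (ν.prod ν) :=
    ((hasAllMoments_eval ν a).mul (hprod S)).integrable.mul_prod (integrable_const (1 : ℝ))
  simp_rw [hc1] at key
  rw [integral_sub (integrable_finsetSum _ fun b _ => hi b) hi',
    integral_finsetSum _ fun b _ => hi b] at key
  have h1 := integral_prod_mul (μ := ν) (ν := ν)
    (fun x : ι → ℝ => x a * ∏ h ∈ S, x (e h)) (fun _ : ι → ℝ => (1 : ℝ))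
  rw [h1] at key
  simp only [integral_const, probReal_univ, smul_eq_mul, mul_one] at key
  rw [← sub_eq_zero, ← neg_eq_zero, ← key, neg_sub]
  congr 1
  refine Finset.sum_congr rfl fun b _ => ?_
  rw [integral_prod_mul (fun x : ι → ℝ => ∏ h ∈ S.erase b, x (e h))
    (fun x : ι → ℝ => x a * x (e b)), mul_comm]

end Stein

/-! ### Perfect matchings and Wick's formula. -/

section Pairings

variable {β : Type*} [LinearOrder β]

/-- All perfect matchings of a finite set `S`, each matching being listed as a multiset of pairs. -/
def pairings (S : Finset β) : Multiset (Multiset (β × β)) :=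
  if h : S.Nonempty then
    -- Always matching the least element first lists each matching exactly once.
    ∑ b ∈ S.erase (S.min' h),
      (pairings ((S.erase (S.min' h)).erase b)).map fun M => (S.min' h, b) ::ₘ M
  else {0}
termination_by S.card
decreasing_by
  exact (Finset.card_erase_le).trans_lt (Finset.card_erase_lt_of_mem (S.min'_mem h))

theorem pairings_empty : pairings (∅ : Finset β) = {0} := by
  rw [pairings]; simp

theorem pairings_of_nonempty {S : Finset β} (h : S.Nonempty) :
    pairings S = ∑ b ∈ S.erase (S.min' h),
      (pairings ((S.erase (S.min' h)).erase b)).map fun M => (S.min' h, b) ::ₘ M := by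
  rw [pairings]; simp [h]

theorem two_mul_card_of_mem_pairings (S : Finset β) :
    ∀ M ∈ pairings S, 2 * M.card = S.card := by
  induction S using Finset.strongInduction with
  | H S ih =>
    intro M hM
    rcases S.eq_empty_or_nonempty with rfl | h
    · rw [pairings_empty, Multiset.mem_singleton] at hM
      simp [hM]
    · rw [pairings_of_nonempty h, Multiset.mem_sum] at hM
      obtain ⟨b, hb, hM⟩ := hM
      obtain ⟨M', hM', rfl⟩ := Multiset.mem_map.1 hM
      have hlt : (S.erase (S.min' h)).erase b ⊂ S :=
        (Finset.erase_subset _ _).trans_ssubset (Finset.erase_ssubset (S.min'_mem h))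
      have h1 := ih _ hlt M' hM'
      have h2 := Finset.card_erase_add_one hb
      have h3 := Finset.card_erase_add_one (S.min'_mem h)
      rw [Multiset.card_cons]
      omega

theorem sum_map_finsetSum {α β R : Type*} [AddCommMonoid R] (T : Finset β) (g : β → Multiset α)
    (F : α → R) : ((∑ b ∈ T, g b).map F).sum = ∑ b ∈ T, ((g b).map F).sum := by
  classical
  induction T using Finset.induction_on with
  | empty => simp
  | insert b T hb ih => simp [Finset.sum_insert hb, ih]

/-- Wick's formula, for a product over colour classes: a set function `m` that obeys the Gaussian
integration by parts recursion with covariance `σ` is given on colour classes by the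
colour-preserving perfect matchings. -/
theorem prod_fiber_eq_sum_pairings {R γ : Type*} [CommRing R] [Fintype γ] [DecidableEq γ]
    (σ : β → β → R) (m : Finset β → R) (h0 : m ∅ = 1)
    (hm : ∀ a S, a ∉ S → m (insert a S) = ∑ b ∈ S, σ a b * m (S.erase b)) (f : β → γ)
    (S : Finset β) :
    ∏ c, m (S.filter fun b => f b = c) =
      ((pairings S).map fun M =>
        (M.map fun p => if f p.1 = f p.2 then σ p.1 p.2 else 0).prod).sum := by
  induction S using Finset.strongInduction with
  | H S ih =>
    rcases S.eq_empty_or_nonempty with rfl | h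
    · simp [pairings_empty, h0]
    rw [pairings_of_nonempty h]
    set a := S.min' h with ha
    have haS : a ∈ S := S.min'_mem h
    set T := S.erase a with hT
    have haT : a ∉ T := Finset.notMem_erase _ _
    have hST : S = insert a T := (Finset.insert_erase haS).symm
    rw [sum_map_finsetSum]
    simp only [Multiset.map_map, Function.comp_def]
    simp only [Multiset.map_cons, Multiset.prod_cons, Multiset.sum_map_mul_left]
    have hfil (c : γ) (hc : c ≠ f a) : S.filter (fun b => f b = c) = T.filter fun b => f b = c := by
      rw [hST, Finset.filter_insert, if_neg (Ne.symm hc)]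
    -- Only the colour class of `a` is affected by removing `a`. The recursion is applied there, and
    -- partners of another colour contribute zero.
    rw [← Finset.mul_prod_erase _ _ (Finset.mem_univ (f a)),
      Finset.prod_congr rfl fun c hc => by rw [hfil c (Finset.ne_of_mem_erase hc)], hST,
      Finset.filter_insert, if_pos rfl, hm _ _ (by simp [haT]), Finset.sum_mul, Finset.sum_filter]
    refine Finset.sum_congr rfl fun b hb => ?_
    by_cases hab : f a = f b
    · have hlt : T.erase b ⊂ S :=
        (Finset.erase_subset _ _).trans_ssubset (Finset.erase_ssubset haS)
      rw [if_pos hab.symm, if_pos hab, ← ih _ hlt, mul_assoc,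
        ← Finset.mul_prod_erase _ _ (Finset.mem_univ (f a)),
        Finset.filter_erase (fun b => f b = _) b T]
      refine congrArg _ (congrArg _ (Finset.prod_congr rfl fun c hc => ?_))
      have hbc : f b ≠ c := fun hbc => Finset.ne_of_mem_erase hc (hab.trans hbc).symm
      rw [Finset.filter_erase (fun b => f b = _) b T, Finset.erase_eq_of_notMem]
      simp [hbc]
    · rw [if_neg (Ne.symm hab), if_neg hab, zero_mul]

end Pairings

/-! ### Colourings and set partitions. -/

section Partitions

variable {ι : Type*} [Fintype ι] [DecidableEq ι]

/-- The map from the index set to `γ` that is injective on the set of blocks of a partition. -/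
def blockColoring {γ : Type*} (x : Σ π : Finpartition (Finset.univ : Finset ι), (π.parts ↪ γ))
    (i : ι) : γ :=
  x.2 ⟨x.1.part i, x.1.part_mem.2 (Finset.mem_univ i)⟩

theorem blockColoring_eq_iff {γ : Type*}
    (x : Σ π : Finpartition (Finset.univ : Finset ι), (π.parts ↪ γ)) (i j : ι) :
    blockColoring x i = blockColoring x j ↔ i ∈ x.1.part j := by
  rw [blockColoring, blockColoring, x.2.injective.eq_iff, Subtype.mk.injEq,
    x.1.mem_part_iff_part_eq_part (Finset.mem_univ _) (Finset.mem_univ _), eq_comm]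

theorem parts_eq_image_part (π : Finpartition (Finset.univ : Finset ι)) :
    π.parts = Finset.univ.image π.part := by
  ext B
  simp only [Finset.mem_image, Finset.mem_univ, true_and]
  constructor
  · intro hB
    obtain ⟨i, hi⟩ := π.nonempty_of_mem_parts hB
    exact ⟨i, π.part_eq_of_mem hB hi⟩
  · rintro ⟨i, rfl⟩
    exact π.part_mem.2 (Finset.mem_univ i)

/-- A colouring is determined by its kernel partition together with the distinct colours given to
the blocks. -/
theorem blockColoring_bijective (γ : Type*) : Function.Bijective
    (blockColoring : (Σ π : Finpartition (Finset.univ : Finset ι), (π.parts ↪ γ)) → ι → γ) := by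
  classical
  constructor
  · rintro ⟨π, g⟩ ⟨π', g'⟩ h
    obtain rfl : π = π' := by
      refine Finpartition.ext ?_
      rw [parts_eq_image_part, parts_eq_image_part]
      congr 1
      ext j i
      have h1 := blockColoring_eq_iff ⟨π, g⟩ i j
      have h2 := blockColoring_eq_iff ⟨π', g'⟩ i j
      rw [h] at h1
      exact h1.symm.trans h2
    congr 1
    ext ⟨B, hB⟩ : 1
    obtain ⟨i, hi⟩ := π.nonempty_of_mem_parts hB
    have := congrFun h i
    simpa [blockColoring, π.part_eq_of_mem hB hi] using this
  · intro f
    set π := Finpartition.ofSetoid (Setoid.ker f) with hπ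
    have hmem (i j : ι) : j ∈ π.part i ↔ f i = f j :=
      (Finpartition.mem_part_ofSetoid_iff_rel).trans Setoid.ker_def
    have hne (B : π.parts) := π.nonempty_of_mem_parts B.2
    have hsame (B : π.parts) (i : ι) (hi : i ∈ B.1) : f (hne B).choose = f i := by
      rw [← hmem, π.part_eq_of_mem B.2 (hne B).choose_spec]
      exact hi
    refine ⟨⟨π, fun B => f (hne B).choose, fun B B' h => ?_⟩, ?_⟩
    · have h' : f (hne B).choose = f (hne B').choose := h
      rw [← hmem, π.part_eq_of_mem B.2 (hne B).choose_spec] at h'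
      exact Subtype.ext (π.eq_of_mem_parts B.2 B'.2 h' (hne B').choose_spec)
    · funext i
      exact hsame _ i (π.mem_part_self.2 (Finset.mem_univ i))

/-- Summing a multiplicative function of the colour classes over all `N`-colourings gives a sum over
set partitions, weighted by falling factorials. -/
theorem sum_prod_fiber_eq_sum_finpartition {R : Type*} [CommRing R] (m : Finset ι → R)
    (h0 : m ∅ = 1) (N : ℕ) :
    ∑ f : ι → Fin N, ∏ c, m (Finset.univ.filter fun i => f i = c) =
      ∑ π : Finpartition (Finset.univ : Finset ι),
        (N.descFactorial π.parts.card : R) * ∏ B ∈ π.parts, m B := by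
  classical
  -- The falling factorial counts the injective colourings of the blocks. Unused colours will
  -- contribute `m ∅ = 1`.
  have hcard (π : Finpartition (Finset.univ : Finset ι)) :
      (N.descFactorial π.parts.card : R) * ∏ B ∈ π.parts, m B =
        ∑ _g : π.parts ↪ Fin N, ∏ B ∈ π.parts, m B := by
    rw [Finset.sum_const, Finset.card_univ, Fintype.card_embedding_eq, nsmul_eq_mul]
    simp
  simp_rw [hcard]
  rw [Finset.sum_sigma', Finset.univ_sigma_univ]
  refine (Fintype.sum_bijective blockColoring (blockColoring_bijective (Fin N)) _ _ ?_).symm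
  rintro ⟨π, g⟩
  rw [← Finset.prod_coe_sort]
  refine Fintype.prod_of_injective g g.injective _ _ (fun c hc => ?_) fun B => ?_
  · rw [Finset.filter_eq_empty_iff.2, h0]
    intro i _ hi
    exact hc ⟨_, hi⟩
  · congr 1
    obtain ⟨j, hj⟩ := π.nonempty_of_mem_parts B.2
    have hB := π.part_eq_of_mem B.2 hj
    have hgj : g B = blockColoring ⟨π, g⟩ j := by
      simp only [blockColoring, hB]
    ext i
    simp only [Finset.mem_filter, Finset.mem_univ, true_and]
    rw [hgj, blockColoring_eq_iff]
    simp only [hB]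

open Polynomial in
-- This is the cumulant weight of a partition into `k + 1` blocks.
theorem coeff_one_descPochhammer (R : Type*) [CommRing R] (k : ℕ) :
    (descPochhammer R (k + 1)).coeff 1 = (-1) ^ k * (k.factorial : R) := by
  induction k with
  | zero => simp
  | succ k ih =>
    have h0 : (descPochhammer R (k + 1)).coeff 0 = 0 := by
      rw [Polynomial.coeff_zero_eq_eval_zero, descPochhammer_ne_zero_eval_zero R k.succ_ne_zero]
    rw [descPochhammer_succ_right, mul_sub, Polynomial.coeff_sub, Polynomial.coeff_mul_X, h0,
      ← C_eq_natCast, Polynomial.coeff_mul_C, ih, Nat.factorial_succ]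
    push_cast
    ring

end Partitions

/-! ### Connected diagrams. -/

section Connected

variable {ι : Type*}

/-- The connected components of the multigraph on `ι` with edges `M`. -/
abbrev Components (M : Multiset (ι × ι)) : Type _ := Quot fun i j : ι => (i, j) ∈ M

/-- The multigraph on `ι` with edges `M` is connected. -/
def IsConn (M : Multiset (ι × ι)) : Prop := Nat.card (Components M) = 1

/-- Without a crossing edge, membership in `A` would descend to the one-point set of components and
be constant. -/
theorem IsConn.exists_crossing [Fintype ι] {M : Multiset (ι × ι)} (hM : IsConn M) {A : Finset ι}
    (hne : A.Nonempty) (hA : A ≠ Finset.univ) :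
    ∃ p ∈ M, (p.1 ∈ A ∧ p.2 ∉ A) ∨ (p.2 ∈ A ∧ p.1 ∉ A) := by
  by_contra! h
  have hl : ∀ i j, (i, j) ∈ M → (i ∈ A) = (j ∈ A) := fun i j hij => propext
    ⟨(h _ hij).1, (h _ hij).2⟩
  obtain ⟨i, hi⟩ := hne
  obtain ⟨j, hj⟩ : ∃ j, j ∉ A := by
    by_contra! hj
    exact hA (Finset.eq_univ_iff_forall.2 hj)
  have hs : Subsingleton (Components M) := (Nat.card_eq_one_iff_unique.1 hM).1
  have := congrArg (Quot.lift (fun i => i ∈ A) hl) (Subsingleton.elim (Quot.mk _ i) (Quot.mk _ j))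
  exact hj (this.mp hi)

/-- Such colourings are exactly the functions on the components. -/
theorem card_constant_on_edges [Fintype ι] [DecidableEq ι] (M : Multiset (ι × ι)) (N : ℕ) :
    (Finset.univ.filter fun f : ι → Fin N => ∀ p ∈ M, f p.1 = f p.2).card =
      N ^ Nat.card (Components M) := by
  classical
  let E : {f : ι → Fin N // ∀ p ∈ M, f p.1 = f p.2} ≃ (Components M → Fin N) :=
    { toFun := fun f => Quot.lift f.1 fun i j hij => f.2 (i, j) hij
      invFun := fun g => ⟨fun i => g (Quot.mk _ i), fun p hp => congrArg g (Quot.sound hp)⟩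
      left_inv := fun f => rfl
      right_inv := fun g => by
        funext q
        induction q using Quot.ind
        rfl }
  rw [← Fintype.card_subtype, ← Nat.card_eq_fintype_card, Nat.card_congr E, Nat.card_fun,
    Nat.card_eq_fintype_card, Fintype.card_fin]

/-- The connected multigraphs on `ι` that arise from the perfect matchings of a set of half-edges,
where `v h` is the vertex at which the half-edge `h` is attached. -/
noncomputable def connectedDiagrams {β : Type*} [LinearOrder β] [Fintype β] (v : β → ι) :
    Multiset (Multiset (ι × ι)) :=
  open Classical in
  ((pairings (Finset.univ : Finset β)).map (Multiset.map (Prod.map v v))).filter IsConn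

theorem even_card_of_mem_connectedDiagrams {β : Type*} [LinearOrder β] [Fintype β] {v : β → ι}
    {M : Multiset (ι × ι)} (hM : M ∈ connectedDiagrams v) : Even (Fintype.card β) := by
  classical
  obtain ⟨M', hM', -⟩ := Multiset.mem_map.1 (Multiset.mem_of_mem_filter hM)
  rw [← Finset.card_univ, ← two_mul_card_of_mem_pairings _ _ hM']
  exact even_two_mul _

theorem isConn_of_mem_connectedDiagrams {β : Type*} [LinearOrder β] [Fintype β] {v : β → ι}
    {M : Multiset (ι × ι)} (hM : M ∈ connectedDiagrams v) : IsConn M :=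
  open Classical in Multiset.of_mem_filter hM

theorem sum_map_filter {α R : Type*} [AddCommMonoid R] (q : α → Prop) [DecidablePred q]
    (s : α → R) (M : Multiset α) :
    ((M.filter q).map s).sum = (M.map fun p => if q p then s p else 0).sum := by
  induction M using Multiset.induction_on with
  | empty => simp
  | cons a M ih => by_cases ha : q a <;> simp [ha, ih]

theorem prod_ite_eq_ite_forall {α R : Type*} [CommRing R] (q : α → Prop) [DecidablePred q]
    (s : α → R) (M : Multiset α) [Decidable (∀ p ∈ M, q p)] :
    (M.map fun p => if q p then s p else 0).prod =
      if ∀ p ∈ M, q p then (M.map s).prod else 0 := by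
  by_cases h : ∀ p ∈ M, q p
  · rw [if_pos h, Multiset.map_congr rfl fun p hp => if_pos (h p hp)]
  · rw [if_neg h]
    push Not at h
    obtain ⟨p, hp, hq⟩ := h
    exact Multiset.prod_eq_zero (Multiset.mem_map.2 ⟨p, hp, if_neg hq⟩)

open Polynomial in
/-- The moment-to-cumulant formula applied to a set function that obeys the Gaussian integration by
parts recursion leaves only the connected diagrams. -/
theorem sum_finpartition_eq_sum_connectedDiagrams [Fintype ι] [DecidableEq ι] [Nonempty ι]
    {β : Type*} [LinearOrder β]
    [Fintype β] (v : β → ι) (σ : ι → ι → ℂ) (m : Finset β → ℂ) (h0 : m ∅ = 1)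
    (hm : ∀ a S, a ∉ S → m (insert a S) = ∑ b ∈ S, σ (v a) (v b) * m (S.erase b)) :
    ∑ π : Finpartition (Finset.univ : Finset ι),
      (-1 : ℂ) ^ (π.parts.card - 1) * ((π.parts.card - 1).factorial : ℂ) *
        ∏ B ∈ π.parts, m (Finset.univ.filter fun b => v b ∈ B) =
      ((connectedDiagrams v).map fun M => (M.map fun p => σ p.1 p.2).prod).sum := by
  classical
  set D := (pairings (Finset.univ : Finset β)).map (Multiset.map (Prod.map v v)) with hD
  set w : Multiset (ι × ι) → ℂ := fun M => (M.map fun p => σ p.1 p.2).prod with hw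
  -- The sum over `N`-colourings is computed in two ways: by kernel partitions, and by Wick's
  -- formula with the sums exchanged.
  have hval (N : ℕ) : ∑ π : Finpartition (Finset.univ : Finset ι),
      (N.descFactorial π.parts.card : ℂ) *
        ∏ B ∈ π.parts, m (Finset.univ.filter fun b => v b ∈ B) =
      (D.map fun M => w M * (N : ℂ) ^ Nat.card (Components M)).sum := by
    rw [← sum_prod_fiber_eq_sum_finpartition
      (fun B => m (Finset.univ.filter fun b => v b ∈ B)) (by simpa using h0)]
    have h1 (f : ι → Fin N) : ∏ c, m (Finset.univ.filter fun b =>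
        v b ∈ Finset.univ.filter fun i => f i = c) =
        (D.map fun M => if ∀ p ∈ M, f p.1 = f p.2 then w M else 0).sum := by
      have := prod_fiber_eq_sum_pairings (fun a b => σ (v a) (v b)) m h0 hm (fun b => f (v b))
        Finset.univ
      simp only [Finset.mem_filter, Finset.mem_univ, true_and]
      rw [this, hD, Multiset.map_map]
      congr 1
      refine Multiset.map_congr rfl fun M _ => ?_
      rw [prod_ite_eq_ite_forall (fun p : β × β => f (v p.1) = f (v p.2))
        (fun p => σ (v p.1) (v p.2))]
      simp only [Function.comp_apply, hw, Multiset.map_map, Multiset.mem_map,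
        forall_exists_index, and_imp, forall_apply_eq_imp_iff₂, Prod.map_fst, Prod.map_snd]
    simp_rw [h1]
    have h2 := Multiset.sum_map_sum_map (Finset.univ : Finset (ι → Fin N)).val D
      (f := fun f M => if ∀ p ∈ M, f p.1 = f p.2 then w M else 0)
    refine h2.trans ?_
    congr 1
    refine Multiset.map_congr rfl fun M _ => ?_
    change ∑ f : ι → Fin N, (if ∀ p ∈ M, f p.1 = f p.2 then w M else 0) = _
    rw [← Finset.sum_filter, Finset.sum_const, card_constant_on_edges, nsmul_eq_mul, mul_comm]
    push_cast
    rfl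
  -- Agreement at all natural `N` is an identity of polynomials, so linear coefficients may be
  -- compared.
  have hpoly : ∑ π : Finpartition (Finset.univ : Finset ι), descPochhammer ℂ π.parts.card *
      C (∏ B ∈ π.parts, m (Finset.univ.filter fun b => v b ∈ B)) =
      (D.map fun M => C (w M) * X ^ Nat.card (Components M)).sum := by
    refine Polynomial.eq_of_infinite_eval_eq _ _
      ((Set.infinite_range_of_injective (Nat.cast_injective (R := ℂ))).mono ?_)
    rintro _ ⟨N, rfl⟩
    have h3 : ((D.map fun M => C (w M) * X ^ Nat.card (Components M)).sum).eval (N : ℂ) =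
        (D.map fun M => w M * (N : ℂ) ^ Nat.card (Components M)).sum := by
      rw [← Polynomial.coe_evalRingHom, map_multiset_sum, Multiset.map_map]
      simp
    rw [Set.mem_ofPred_eq, h3, ← hval, Polynomial.eval_finsetSum]
    simp [descPochhammer_eval_eq_descFactorial, Polynomial.eval_prod]
  have hcoeff := congrArg (fun q => Polynomial.coeff q 1) hpoly
  simp only [Polynomial.finsetSum_coeff, Polynomial.coeff_mul_C] at hcoeff
  have h4 : ((D.map fun M => C (w M) * X ^ Nat.card (Components M)).sum).coeff 1 =
      ((D.filter IsConn).map w).sum := by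
    have := map_multiset_sum (Polynomial.lcoeff ℂ 1)
      (D.map fun M => C (w M) * X ^ Nat.card (Components M))
    rw [Polynomial.lcoeff_apply] at this
    rw [this, Multiset.map_map, sum_map_filter]
    congr 1
    refine Multiset.map_congr rfl fun M _ => ?_
    simp [IsConn, Polynomial.coeff_X_pow, eq_comm]
  rw [h4] at hcoeff
  rw [show connectedDiagrams v = D.filter IsConn from rfl, ← hcoeff]
  refine Finset.sum_congr rfl fun π _ => ?_
  obtain ⟨k, hk⟩ : ∃ k, π.parts.card = k + 1 := by
    refine Nat.exists_eq_succ_of_ne_zero (Finset.card_ne_zero.2 (π.parts_nonempty ?_))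
    simpa using (Finset.univ_nonempty (α := ι)).ne_empty
  rw [hk, coeff_one_descPochhammer, Nat.add_sub_cancel]

end Connected

/-! ### Multilinearity of joint cumulants. -/

section Multilinear

variable {A : Type*} [CommRing A] [Algebra ℂ A] {ι : Type*} [Fintype ι] [inst : DecidableEq ι]

/-- Exactly one block contains `i`; isolating it shows linearity in the `i`-th argument. -/
theorem prod_block_update (φ : A →ₗ[ℂ] ℂ) (π : Finpartition (Finset.univ : Finset ι))
    (Z : ι → A) (i : ι) (x : A) :
    ∏ B ∈ π.parts, φ (∏ j ∈ B, Function.update Z i x j) =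
      φ (x * ∏ j ∈ (π.part i).erase i, Z j) *
        ∏ B ∈ π.parts.erase (π.part i), φ (∏ j ∈ B, Z j) := by
  have hi : i ∈ π.part i := π.mem_part_self.2 (Finset.mem_univ i)
  rw [← Finset.mul_prod_erase _ _ (π.part_mem.2 (Finset.mem_univ i)),
    ← Finset.mul_prod_erase _ _ hi, Function.update_self]
  congr 1
  · congr 2
    exact Finset.prod_congr rfl fun j hj => Function.update_of_ne (Finset.ne_of_mem_erase hj) _ _
  · refine Finset.prod_congr rfl fun B hB => ?_
    congr 1
    refine Finset.prod_congr rfl fun j hj => Function.update_of_ne ?_ _ _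
    rintro rfl
    exact Finset.ne_of_mem_erase hB (π.part_eq_of_mem (Finset.mem_of_mem_erase hB) hj).symm

/-- The product over the blocks of a partition of the values of a linear functional on products,
as a multilinear map. -/
def blockMoments (φ : A →ₗ[ℂ] ℂ) (π : Finpartition (Finset.univ : Finset ι)) :
    MultilinearMap ℂ (fun _ : ι => A) ℂ where
  toFun Z := ∏ B ∈ π.parts, φ (∏ i ∈ B, Z i)
  map_update_add' := @fun inst' Z i x y => by
    rw [Subsingleton.elim inst' inst]
    simp only [prod_block_update, add_mul, map_add]
  map_update_smul' := @fun inst' Z i c x => by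
    rw [Subsingleton.elim inst' inst]
    simp only [prod_block_update, smul_mul_assoc, map_smul]

/-- The joint cumulant with respect to a linear functional, as a multilinear map. -/
def cumulantMap (φ : A →ₗ[ℂ] ℂ) : MultilinearMap ℂ (fun _ : ι => A) ℂ :=
  ∑ π : Finpartition (Finset.univ : Finset ι),
    ((-1 : ℂ) ^ (π.parts.card - 1) * ((π.parts.card - 1).factorial : ℂ)) • blockMoments φ π

theorem cumulantMap_apply (φ : A →ₗ[ℂ] ℂ) (Z : ι → A) :
    cumulantMap φ Z = ∑ π : Finpartition (Finset.univ : Finset ι),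
      (-1 : ℂ) ^ (π.parts.card - 1) * ((π.parts.card - 1).factorial : ℂ) *
        ∏ B ∈ π.parts, φ (∏ i ∈ B, Z i) := by
  simp [cumulantMap, blockMoments]

end Multilinear

/-! ### Expectation as a linear functional on polynomials. -/

section Expectation

variable {Ω I : Type*} [MeasurableSpace Ω] {P : Measure Ω} [IsProbabilityMeasure P]
  {Y : I → Ω → ℝ}

theorem hasAllMoments_aeval (hY : ∀ e, HasAllMoments (Y e) P) (p : MvPolynomial I ℂ) :
    HasAllMoments (fun ω => MvPolynomial.aeval (fun e => (Y e ω : ℂ)) p) P := by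
  induction p using MvPolynomial.induction_on with
  | C a => simpa using HasAllMoments.const a
  | add p q hp hq => simpa using hp.add hq
  | mul_X p e hp => simpa using hp.mul fun q hq => (hY e q hq).ofReal

/-- The expectation of a polynomial in the random variables `Y e`. -/
noncomputable def polyExpectation (hY : ∀ e, HasAllMoments (Y e) P) : MvPolynomial I ℂ →ₗ[ℂ] ℂ where
  toFun p := ∫ ω, MvPolynomial.aeval (fun e => (Y e ω : ℂ)) p ∂P
  map_add' p q := by
    simp only [map_add]
    exact integral_add (hasAllMoments_aeval hY p).integrable (hasAllMoments_aeval hY q).integrable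
  map_smul' a p := by
    simp only [map_smul, RingHom.id_apply]
    exact integral_smul a _

/-- Moves the computation to the polynomial algebra, where multilinear expansion has no
integrability side conditions. -/
theorem jointCumulant_aeval (hY : ∀ e, HasAllMoments (Y e) P) {r : ℕ}
    (p : Fin r → MvPolynomial I ℂ) :
    jointCumulant P (fun i ω => MvPolynomial.aeval (fun e => (Y e ω : ℂ)) (p i)) =
      cumulantMap (polyExpectation hY) p := by
  simp [jointCumulant, cumulantMap_apply, polyExpectation, map_prod]

end Expectation

/-! ### Cumulants of powers of Gaussian variables. -/

section GaussianMoments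

variable {I Ω : Type*} [Fintype I] [MeasurableSpace Ω] {P : Measure Ω} {Y : I → Ω → ℝ}

theorem hasAllMoments_of_hasGaussianLaw (hY : HasGaussianLaw (fun ω e => Y e ω) P) (e : I) :
    HasAllMoments (Y e) P := fun p hp => by
  have := (hY.memLp hp).continuousLinearMap_comp (ContinuousLinearMap.proj (R := ℝ) e)
  exact this

/-- Gaussian integration by parts for a centred jointly Gaussian family. -/
theorem integral_prod_insert (hY : HasGaussianLaw (fun ω e => Y e ω) P)
    (h0 : ∀ e, ∫ ω, Y e ω ∂P = 0) {β : Type*} [DecidableEq β] (e : β → I) (a : β) (S : Finset β)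
    (ha : a ∉ S) :
    ∫ ω, ∏ h ∈ insert a S, (Y (e h) ω : ℂ) ∂P =
      ∑ b ∈ S, ((cov[Y (e a), Y (e b); P] : ℝ) : ℂ) * ∫ ω, ∏ h ∈ S.erase b, (Y (e h) ω : ℂ) ∂P := by
  have hmeas : AEMeasurable (fun ω e => Y e ω) P := hY.aemeasurable
  set ν := P.map fun ω e => Y e ω with hν
  have hG : IsGaussian ν := hY.isGaussian_map
  have hν0 : ∫ x, x ∂ν = 0 := by
    ext i
    have := IsGaussian.integral_dual (μ := ν) (ContinuousLinearMap.proj (R := ℝ) i)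
    simp only [ContinuousLinearMap.proj_apply] at this
    rw [← this, hν, integral_map hmeas (measurable_pi_apply i).aestronglyMeasurable]
    simpa using h0 i
  have key := integral_mul_prod_of_isGaussian ν hν0 S e (e a)
  have hprod (T : Finset β) : ∫ x : I → ℝ, ∏ h ∈ T, x (e h) ∂ν = ∫ ω, ∏ h ∈ T, Y (e h) ω ∂P :=
    integral_map hmeas (Finset.measurable_fun_prod T fun h _ =>
      measurable_pi_apply (e h)).aestronglyMeasurable
  have hcov (b : β) : ∫ x : I → ℝ, x (e a) * x (e b) ∂ν = cov[Y (e a), Y (e b); P] := by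
    have hab : Measurable fun x : I → ℝ => x (e a) * x (e b) :=
      (measurable_pi_apply (e a)).mul (measurable_pi_apply (e b))
    rw [hν, integral_map hmeas hab.aestronglyMeasurable, covariance]
    simp [h0]
  have hins : ∫ x : I → ℝ, x (e a) * ∏ h ∈ S, x (e h) ∂ν =
      ∫ ω, ∏ h ∈ insert a S, Y (e h) ω ∂P := by
    rw [← hprod]
    simp_rw [Finset.prod_insert ha]
  simp_rw [hins, hcov, hprod] at key
  have hcast (T : Finset β) : ∫ ω, ∏ h ∈ T, (Y (e h) ω : ℂ) ∂P =
      ((∫ ω, ∏ h ∈ T, Y (e h) ω ∂P : ℝ) : ℂ) := by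
    simpa using integral_ofReal (𝕜 := ℂ) (μ := P) (f := fun ω => ∏ h ∈ T, Y (e h) ω)
  simp_rw [hcast]
  rw [key]
  push_cast
  rfl

/-- The vertex at which a half-edge is attached, when there are `ℓ i` half-edges at vertex `i`. -/
def halfEdgeVertex {r : ℕ} (ℓ : Fin r → ℕ) (h : Fin (∑ i, ℓ i)) : Fin r :=
  (finSigmaFinEquiv.symm h).1

/-- The connected diagrams with `ℓ i` half-edges at vertex `i`. -/
noncomputable def diagrams {r : ℕ} (ℓ : Fin r → ℕ) : Multiset (Multiset (Fin r × Fin r)) :=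
  connectedDiagrams (halfEdgeVertex ℓ)

theorem even_of_mem_diagrams {r : ℕ} {ℓ : Fin r → ℕ} {M : Multiset (Fin r × Fin r)}
    (hM : M ∈ diagrams ℓ) : Even (∑ i, ℓ i) := by
  simpa using even_card_of_mem_connectedDiagrams hM

theorem prod_halfEdgeVertex {R : Type*} [CommMonoid R] {r : ℕ} (ℓ : Fin r → ℕ) (y : Fin r → R)
    (B : Finset (Fin r)) :
    ∏ h with halfEdgeVertex ℓ h ∈ B, y (halfEdgeVertex ℓ h) = ∏ i ∈ B, y i ^ ℓ i := by
  rw [Finset.prod_filter, ← Equiv.prod_comp finSigmaFinEquiv]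
  simp only [halfEdgeVertex, Equiv.symm_apply_apply]
  rw [Fintype.prod_sigma]
  simp [Finset.prod_ite_mem]

/-- The joint cumulant of powers of jointly Gaussian variables is a sum over connected diagrams. -/
theorem cumulantMap_powers [IsProbabilityMeasure P] (hY : HasGaussianLaw (fun ω e => Y e ω) P)
    (h0 : ∀ e, ∫ ω, Y e ω ∂P = 0) {r : ℕ} (hr : 1 ≤ r) (ℓ : Fin r → ℕ) (e : Fin r → I) :
    cumulantMap (polyExpectation fun e => hasAllMoments_of_hasGaussianLaw hY e)
        (fun i => (MvPolynomial.X (e i) : MvPolynomial I ℂ) ^ ℓ i) =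
      ((diagrams ℓ).map fun M =>
        (M.map fun p => ((cov[Y (e p.1), Y (e p.2); P] : ℝ) : ℂ)).prod).sum := by
  have : Nonempty (Fin r) := ⟨⟨0, hr⟩⟩
  rw [diagrams, ← sum_finpartition_eq_sum_connectedDiagrams (halfEdgeVertex ℓ)
    (fun i j => ((cov[Y (e i), Y (e j); P] : ℝ) : ℂ))
    (fun S => ∫ ω, ∏ h ∈ S, (Y (e (halfEdgeVertex ℓ h)) ω : ℂ) ∂P) (by simp)
    (fun a S ha => integral_prod_insert hY h0 (fun h => e (halfEdgeVertex ℓ h)) a S ha),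
    cumulantMap_apply]
  refine Finset.sum_congr rfl fun π _ => ?_
  congr 1
  refine Finset.prod_congr rfl fun B _ => ?_
  simp only [polyExpectation, LinearMap.coe_mk, AddHom.coe_mk, map_prod, map_pow,
    MvPolynomial.aeval_X]
  congr 1
  funext ω
  exact (prod_halfEdgeVertex ℓ (fun i => (Y (e i) ω : ℂ)) B).symm

end GaussianMoments

/-! ### Diagram expansion of the polynomial functional. -/

section Expansion

variable {n : ℕ} {Ω : Type*}

open Classical in
/-- The coefficients, with those that do not occur in `polyFunctional` replaced by zero. -/
noncomputable def redCoeff (c : ℕ → Sym2 (Fin n) → ℂ) (ℓ : ℕ) (e : Sym2 (Fin n)) : ℂ :=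
  if ℓ = 2 ∨ (ℓ = 1 ↔ e.IsDiag) then c ℓ e else 0

theorem sum_isDiag {R : Type*} [AddCommMonoid R] (g : Sym2 (Fin n) → R) :
    ∑ e : Sym2 (Fin n) with e.IsDiag, g e = ∑ j : Fin n, g s(j, j) := by
  have : (Finset.univ.filter fun e : Sym2 (Fin n) => e.IsDiag) =
      Finset.univ.map ⟨Sym2.diag, Sym2.diag_injective⟩ := by
    ext e
    simp only [Finset.mem_filter, Finset.mem_univ, true_and, Finset.mem_map,
      Function.Embedding.coeFn_mk]
    induction e using Sym2.ind with
    | _ a b =>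
      rw [Sym2.mk_isDiag_iff]
      constructor
      · rintro rfl
        exact ⟨a, rfl⟩
      · rintro ⟨j, hj⟩
        rw [Sym2.diag, Sym2.eq_iff] at hj
        aesop
  rw [this, Finset.sum_map]
  rfl

theorem polyFunctional_eq_sum {L : ℕ} (hL : 2 ≤ L) (c : ℕ → Sym2 (Fin n) → ℂ)
    (Y : Sym2 (Fin n) → Ω → ℝ) (ω : Ω) :
    polyFunctional L c Y ω =
      ∑ ℓ ∈ Finset.Icc 1 L, ∑ e, redCoeff c ℓ e * (Y e ω : ℂ) ^ ℓ := by
  have hIcc : Finset.Icc 1 L = insert 1 (insert 2 (Finset.Icc 3 L)) := by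
    ext x; simp only [Finset.mem_Icc, Finset.mem_insert]; omega
  rw [hIcc, Finset.sum_insert (by simp), Finset.sum_insert (by simp), polyFunctional, add_assoc]
  refine congrArg₂ _ ?_ (congrArg₂ _ ?_ ?_)
  · rw [← sum_isDiag fun e => c 1 e * (Y e ω : ℂ), Finset.sum_filter]
    refine Finset.sum_congr rfl fun e _ => ?_
    by_cases he : e.IsDiag <;> simp [redCoeff, he]
  · simp [redCoeff]
  · refine Finset.sum_congr rfl fun ℓ hℓ => ?_
    rw [Finset.sum_filter]
    refine Finset.sum_congr rfl fun e _ => ?_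
    have h3 := (Finset.mem_Icc.1 hℓ).1
    have h1 : ℓ ≠ 1 := by omega
    have h2 : ℓ ≠ 2 := by omega
    by_cases he : e.IsDiag <;> simp [redCoeff, he, h1, h2]

/-- The diagram expansion of the cumulants of a polynomial functional of a Gaussian family. -/
theorem cumulant_polyFunctional [MeasurableSpace Ω] {P : Measure Ω} [IsProbabilityMeasure P]
    {B : ℝ} {Y : Sym2 (Fin n) → Ω → ℝ}
    (hY : IsGaussianFamily P B Y) {r L : ℕ} (hr : 1 ≤ r) (hL : 2 ≤ L)
    (c : ℕ → Sym2 (Fin n) → ℂ) :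
    cumulant P r (polyFunctional L c Y) =
      ∑ ℓ ∈ Fintype.piFinset fun _ : Fin r => Finset.Icc 1 L, ∑ e : Fin r → Sym2 (Fin n),
        (∏ i, redCoeff c (ℓ i) (e i)) * ((diagrams ℓ).map fun M =>
          (M.map fun p => ((cov[Y (e p.1), Y (e p.2); P] : ℝ) : ℂ)).prod).sum := by
  have hm := fun e => hasAllMoments_of_hasGaussianLaw hY.gaussian e
  set p : MvPolynomial (Sym2 (Fin n)) ℂ :=
    ∑ ℓ ∈ Finset.Icc 1 L, ∑ e, redCoeff c ℓ e • MvPolynomial.X e ^ ℓ with hp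
  have hZ : polyFunctional L c Y = fun ω => MvPolynomial.aeval (fun e => (Y e ω : ℂ)) p := by
    funext ω
    rw [polyFunctional_eq_sum hL, hp]
    simp [map_sum]
  rw [cumulant, hZ, jointCumulant_aeval hm (fun _ => p)]
  simp only [hp]
  rw [MultilinearMap.map_sum_finset (cumulantMap (polyExpectation hm))
    (fun (_ : Fin r) ℓ => ∑ e, redCoeff c ℓ e • (MvPolynomial.X e : MvPolynomial _ ℂ) ^ ℓ)
    (fun _ => Finset.Icc 1 L)]
  refine Finset.sum_congr rfl fun ℓ _ => ?_
  rw [MultilinearMap.map_sum]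
  refine Finset.sum_congr rfl fun e _ => ?_
  rw [MultilinearMap.map_smul_univ, smul_eq_mul, cumulantMap_powers hY.gaussian hY.mean_zero hr]

end Expansion

/-! ### Differences of products. -/

section Telescoping

theorem norm_multiset_prod_le {α : Type*} (M : Multiset α) {s : α → ℂ} {d : α → ℝ}
    (hs : ∀ p, ‖s p‖ ≤ d p) : ‖(M.map s).prod‖ ≤ (M.map d).prod := by
  induction M using Multiset.induction_on with
  | empty => simp
  | cons a M ih =>
    rw [Multiset.map_cons, Multiset.prod_cons, Multiset.map_cons, Multiset.prod_cons, norm_mul]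
    exact mul_le_mul (hs a) ih (norm_nonneg _) ((norm_nonneg _).trans (hs a))

/-- The factors are exchanged one at a time. `M.erase p` removes a single copy, as diagrams may have
repeated edges. -/
theorem norm_multiset_prod_sub_prod_le {α : Type*} [DecidableEq α] (M : Multiset α)
    {s s' : α → ℂ} {d : α → ℝ} (hs : ∀ p, ‖s p‖ ≤ d p) (hs' : ∀ p, ‖s' p‖ ≤ d p) :
    ‖(M.map s).prod - (M.map s').prod‖ ≤
      (M.map fun p => ‖s p - s' p‖ * ((M.erase p).map d).prod).sum := by
  induction M using Multiset.induction_on with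
  | empty => simp
  | cons a M ih =>
    have htail : (M.map fun p => ‖s p - s' p‖ * (((a ::ₘ M).erase p).map d).prod) =
        M.map fun p => d a * (‖s p - s' p‖ * ((M.erase p).map d).prod) := by
      refine Multiset.map_congr rfl fun p hp => ?_
      have : (a ::ₘ M).erase p = a ::ₘ M.erase p := by
        by_cases h : a = p
        · subst h
          rw [Multiset.erase_cons_head, Multiset.cons_erase hp]
        · rw [Multiset.erase_cons_tail _ h]
      rw [this, Multiset.map_cons, Multiset.prod_cons]
      ring
    rw [Multiset.map_cons (fun p => ‖s p - s' p‖ * (((a ::ₘ M).erase p).map d).prod),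
      Multiset.sum_cons, htail, Multiset.sum_map_mul_left, Multiset.erase_cons_head]
    simp only [Multiset.map_cons, Multiset.prod_cons]
    have h1 : s a * (M.map s).prod - s' a * (M.map s').prod =
        (s a - s' a) * (M.map s).prod + s' a * ((M.map s).prod - (M.map s').prod) := by ring
    rw [h1]
    refine (norm_add_le _ _).trans (add_le_add ?_ ?_)
    · rw [norm_mul]
      exact mul_le_mul_of_nonneg_left (norm_multiset_prod_le M hs) (norm_nonneg _)
    · rw [norm_mul]
      exact mul_le_mul (hs' a) ih (norm_nonneg _) ((norm_nonneg _).trans (hs' a))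

theorem norm_finset_prod_sub_prod_le {α : Type*} [DecidableEq α] (S : Finset α)
    {s s' : α → ℂ} {d : α → ℝ} (hs : ∀ p, ‖s p‖ ≤ d p) (hs' : ∀ p, ‖s' p‖ ≤ d p) :
    ‖∏ p ∈ S, s p - ∏ p ∈ S, s' p‖ ≤ ∑ p ∈ S, ‖s p - s' p‖ * ∏ q ∈ S.erase p, d q := by
  simpa only [Finset.prod, Finset.sum, Finset.erase_val] using
    norm_multiset_prod_sub_prod_le S.val hs hs'

theorem norm_multiset_sum_map_le {α : Type*} (M : Multiset α) {s : α → ℂ} {d : α → ℝ}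
    (hs : ∀ p ∈ M, ‖s p‖ ≤ d p) : ‖(M.map s).sum‖ ≤ (M.map d).sum := by
  induction M using Multiset.induction_on with
  | empty => simp
  | cons a M ih =>
    rw [Multiset.map_cons, Multiset.sum_cons, Multiset.map_cons, Multiset.sum_cons]
    exact (norm_add_le _ _).trans (add_le_add (hs a (by simp))
      (ih fun p hp => hs p (Multiset.mem_cons_of_mem hp)))

end Telescoping

/-! ### Summation along a spanning tree. -/

section SpanningTree

variable {ι E : Type*} [DecidableEq ι]

/-- Some edge of `M` joins `A` to its complement. -/
def Crosses (M : Multiset (ι × ι)) (A : Finset ι) : Prop :=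
  ∃ p ∈ M, (p.1 ∈ A ∧ p.2 ∉ A) ∨ (p.2 ∈ A ∧ p.1 ∉ A)

/-- An edge with both ends in `A` is not the crossing one, so an edge already used can be dropped.
-/
theorem Crosses.erase {M : Multiset (ι × ι)} {A : Finset ι} {p : ι × ι} (h : Crosses M A)
    (h1 : p.1 ∈ A) (h2 : p.2 ∈ A) : Crosses (M.erase p) A := by
  obtain ⟨q, hq, hq'⟩ := h
  refine ⟨q, (Multiset.mem_erase_of_ne ?_).2 hq, hq'⟩
  rintro rfl
  tauto

theorem multiset_prod_nonneg {α : Type*} (M : Multiset α) {d : α → ℝ} (h : ∀ a, 0 ≤ d a) :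
    0 ≤ (M.map d).prod := by
  refine Multiset.prod_nonneg fun x hx => ?_
  obtain ⟨a, -, rfl⟩ := Multiset.mem_map.1 hx
  exact h a

theorem multiset_prod_le_one {α : Type*} (M : Multiset α) {d : α → ℝ} (h : ∀ a, 0 ≤ d a)
    (h1 : ∀ a, d a ≤ 1) : (M.map d).prod ≤ 1 := by
  induction M using Multiset.induction_on with
  | empty => simp
  | cons a M ih =>
    rw [Multiset.map_cons, Multiset.prod_cons]
    exact mul_le_one₀ (h1 a) (multiset_prod_nonneg M h) ih

variable [Fintype ι] [Fintype E]

/-- Exchanging `x` with the value `e v` is an involution on pairs `(e, x)`. This allows one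
coordinate to be summed without leaving `ι → E`. -/
theorem sum_sum_update (H : (ι → E) → ℝ) (v : ι) :
    ∑ e : ι → E, ∑ x : E, H (Function.update e v x) = Fintype.card E * ∑ e, H e := by
  let φ : (ι → E) × E → (ι → E) × E := fun z => (Function.update z.1 v z.2, z.1 v)
  have hφ : Function.Involutive φ := fun z => by simp [φ]
  rw [← Fintype.sum_prod_type' (fun e x => H (Function.update e v x))]
  have := Fintype.sum_bijective φ hφ.bijective (fun z => H (φ z).1) (fun z => H z.1) fun _ => rfl
  refine this.trans ?_
  rw [Fintype.sum_prod_type]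
  simp [Finset.mul_sum]

/-- Summing out, one by one, the vertices outside `A` along the edges of a multigraph in which
every vertex is joined to `A`. -/
theorem card_pow_mul_sum_le {w : E → ℝ} {b : E → E → ℝ} {κ : ℝ} (hw : ∀ x, 0 ≤ w x)
    (hb : ∀ x y, 0 ≤ b x y) (hb1 : ∀ x y, b x y ≤ 1) (hsymm : ∀ x y, b x y = b y x)
    (hκ : ∀ x, ∑ y, w y * b x y ≤ κ) (k : ℕ) :
    ∀ (A : Finset ι) (M : Multiset (ι × ι)) (F : (ι → E) → ℝ), Aᶜ.card = k →
      (∀ A', A ⊆ A' → A' ≠ Finset.univ → Crosses M A') → (∀ e, 0 ≤ F e) →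
      (∀ e v x, v ∉ A → F (Function.update e v x) = F e) →
      (Fintype.card E : ℝ) ^ k *
        ∑ e, F e * (∏ j ∈ Aᶜ, w (e j)) * (M.map fun p => b (e p.1) (e p.2)).prod ≤
        κ ^ k * ∑ e, F e := by
  -- Sums always run over all of `ι → E`, although `F` depends only on coordinates in `A`; the
  -- factor `card E ^ k` corrects for the `k` idle coordinates in `∑ e, F e`.
  induction k with
  | zero =>
    intro A M F hA _ hF _
    rw [Finset.card_eq_zero] at hA
    simp only [hA, Finset.prod_empty, mul_one, pow_zero, one_mul]
    exact Finset.sum_le_sum fun e _ => mul_le_of_le_one_right (hF e)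
      (multiset_prod_le_one M (fun p => hb _ _) fun p => hb1 _ _)
  | succ k ih =>
    intro A M F hA hM hF hFA
    have hne : A ≠ Finset.univ := by
      rintro rfl
      simp at hA
    obtain ⟨p, hp, hcr⟩ := hM A subset_rfl hne
    obtain ⟨a, v, ha, hv, hpb⟩ : ∃ a v, a ∈ A ∧ v ∉ A ∧ (∀ e : ι → E,
        b (e p.1) (e p.2) = b (e a) (e v)) ∧
        ∀ A' : Finset ι, a ∈ A' → v ∈ A' → p.1 ∈ A' ∧ p.2 ∈ A' := by
      rcases hcr with h | h
      · exact ⟨p.1, p.2, h.1, h.2, fun _ => rfl, fun _ h1 h2 => ⟨h1, h2⟩⟩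
      · exact ⟨p.2, p.1, h.1, h.2, fun _ => hsymm _ _, fun _ h1 h2 => ⟨h2, h1⟩⟩
    have hav : a ≠ v := fun h => hv (h ▸ ha)
    have hcompl : Aᶜ = insert v (insert v A)ᶜ := by
      ext j
      simp only [Finset.mem_compl, Finset.mem_insert]
      by_cases hj : j = v <;> simp [hj, hv]
    have hvc : v ∉ (insert v A)ᶜ := by simp
    have hcard : (insert v A)ᶜ.card = k := by
      rw [hcompl, Finset.card_insert_of_notMem hvc] at hA
      omega
    -- The crossing edge and the weight of its outer end `v` are absorbed into `F`, and `v` joins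
    -- `A`. Summing over `e v` later costs `κ` (`hstep`).
    set F' : (ι → E) → ℝ := fun e => F e * (w (e v) * b (e a) (e v)) with hF'
    have key := ih (insert v A) (M.erase p) F' hcard
      (fun A' hA' hA'1 => by
        have h := hpb.2 A' (hA' (Finset.mem_insert_of_mem ha)) (hA' (Finset.mem_insert_self _ _))
        exact (hM A' ((Finset.subset_insert _ _).trans hA') hA'1).erase h.1 h.2)
      (fun e => mul_nonneg (hF e) (mul_nonneg (hw _) (hb _ _)))
      (fun e u x hu => by
        rw [Finset.mem_insert, not_or] at hu
        have hua : a ≠ u := fun h => hu.2 (h ▸ ha)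
        simp only [hF', hFA e u x hu.2, Function.update_of_ne (Ne.symm hu.1),
          Function.update_of_ne hua])
    have hterm (e : ι → E) :
        F e * (∏ j ∈ Aᶜ, w (e j)) * (M.map fun p => b (e p.1) (e p.2)).prod =
        F' e * (∏ j ∈ (insert v A)ᶜ, w (e j)) *
          ((M.erase p).map fun p => b (e p.1) (e p.2)).prod := by
      rw [hcompl, Finset.prod_insert hvc, ← Multiset.cons_erase hp, Multiset.map_cons,
        Multiset.prod_cons, hpb.1, Multiset.erase_cons_head]
      simp only [hF']
      ring
    have hstep : (Fintype.card E : ℝ) * ∑ e, F' e ≤ κ * ∑ e, F e := by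
      rw [← sum_sum_update F' v, Finset.mul_sum]
      refine Finset.sum_le_sum fun e _ => ?_
      simp only [hF', hFA e v _ hv, Function.update_self, Function.update_of_ne hav]
      rw [← Finset.mul_sum, mul_comm]
      exact mul_le_mul_of_nonneg_right (hκ _) (hF e)
    have hκ0 : 0 ≤ κ ∨ IsEmpty E := by
      rcases isEmpty_or_nonempty E with h | ⟨⟨x⟩⟩
      · exact Or.inr h
      · exact Or.inl ((Finset.sum_nonneg fun y _ => mul_nonneg (hw y) (hb x y)).trans (hκ x))
    rcases hκ0 with hκ0 | hE
    · simp_rw [hterm]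
      calc (Fintype.card E : ℝ) ^ (k + 1) * ∑ e, F' e * (∏ j ∈ (insert v A)ᶜ, w (e j)) *
            ((M.erase p).map fun p => b (e p.1) (e p.2)).prod
          = Fintype.card E * ((Fintype.card E : ℝ) ^ k *
            ∑ e, F' e * (∏ j ∈ (insert v A)ᶜ, w (e j)) *
            ((M.erase p).map fun p => b (e p.1) (e p.2)).prod) := by ring
        _ ≤ Fintype.card E * (κ ^ k * ∑ e, F' e) :=
            mul_le_mul_of_nonneg_left key (Nat.cast_nonneg _)
        _ = κ ^ k * (Fintype.card E * ∑ e, F' e) := by ring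
        _ ≤ κ ^ k * (κ * ∑ e, F e) := mul_le_mul_of_nonneg_left hstep (pow_nonneg hκ0 _)
        _ = κ ^ (k + 1) * ∑ e, F e := by ring
    · have : IsEmpty (ι → E) := ⟨fun e => hE.elim (e v)⟩
      simp

theorem sum_single_coordinate (F : E → ℝ) (i : ι) :
    (Fintype.card E : ℝ) * ∑ e : ι → E, F (e i) =
      (Fintype.card E : ℝ) ^ Fintype.card ι * ∑ x, F x := by
  rw [← sum_sum_update (fun e : ι → E => F (e i)) i]
  simp

theorem sum_pair_coordinates (F : E → E → ℝ) {i j : ι} (hij : i ≠ j) :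
    (Fintype.card E : ℝ) ^ 2 * ∑ e : ι → E, F (e i) (e j) =
      (Fintype.card E : ℝ) ^ Fintype.card ι * ∑ x, ∑ y, F x y := by
  rw [sq, mul_assoc, ← sum_sum_update (fun e : ι → E => F (e i) (e j)) j]
  simp only [Function.update_self, Function.update_of_ne hij]
  exact sum_single_coordinate (fun x => ∑ y, F x y) i

variable [Nonempty E]

theorem sum_le_of_root {w : E → ℝ} {b : E → E → ℝ} {κ : ℝ} (hw : ∀ x, 0 ≤ w x)
    (hb : ∀ x y, 0 ≤ b x y) (hb1 : ∀ x y, b x y ≤ 1) (hsymm : ∀ x y, b x y = b y x)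
    (hκ : ∀ x, ∑ y, w y * b x y ≤ κ) (i : ι) (M : Multiset (ι × ι)) {F : E → ℝ}
    (hM : ∀ A : Finset ι, i ∈ A → A ≠ Finset.univ → Crosses M A) (hF : ∀ x, 0 ≤ F x) :
    ∑ e : ι → E, F (e i) * (∏ j ∈ Finset.univ.erase i, w (e j)) *
      (M.map fun p => b (e p.1) (e p.2)).prod ≤ κ ^ (Fintype.card ι - 1) * ∑ x, F x := by
  have hc : ({i} : Finset ι)ᶜ = Finset.univ.erase i := by ext; simp
  have hcard : ({i} : Finset ι)ᶜ.card = Fintype.card ι - 1 := by simp [Finset.card_compl]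
  have key := card_pow_mul_sum_le hw hb hb1 hsymm hκ _ {i} M (fun e : ι → E => F (e i)) hcard
    (fun A' h => hM A' (h (Finset.mem_singleton_self i))) (fun e => hF _)
    (fun e v x hv => by rw [Function.update_of_ne (by simpa [eq_comm] using hv)])
  rw [hc] at key
  have hE : (0 : ℝ) < Fintype.card E := Nat.cast_pos.2 Fintype.card_pos
  have hι : Fintype.card ι = Fintype.card ι - 1 + 1 :=
    (Nat.succ_pred_eq_of_pos (Fintype.card_pos_iff.2 ⟨i⟩)).symm
  have h1 := sum_single_coordinate (ι := ι) F i
  rw [hι, pow_succ', mul_assoc] at h1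
  rw [mul_left_cancel₀ hE.ne' h1, mul_left_comm] at key
  exact le_of_mul_le_mul_left key (pow_pos hE _)

theorem sum_le_of_root_edge {w : E → ℝ} {b : E → E → ℝ} {κ : ℝ} (hw : ∀ x, 0 ≤ w x)
    (hb : ∀ x y, 0 ≤ b x y) (hb1 : ∀ x y, b x y ≤ 1) (hsymm : ∀ x y, b x y = b y x)
    (hκ : ∀ x, ∑ y, w y * b x y ≤ κ) {i j : ι} (hij : i ≠ j) (M : Multiset (ι × ι)) {F : E → E → ℝ}
    (hM : ∀ A : Finset ι, i ∈ A → j ∈ A → A ≠ Finset.univ → Crosses M A)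
    (hF : ∀ x y, 0 ≤ F x y) :
    ∑ e : ι → E, F (e i) (e j) * (∏ k ∈ ({i, j} : Finset ι)ᶜ, w (e k)) *
      (M.map fun p => b (e p.1) (e p.2)).prod ≤
        κ ^ (Fintype.card ι - 2) * ∑ x, ∑ y, F x y := by
  have hcard2 : ({i, j} : Finset ι).card = 2 := Finset.card_pair hij
  have hcard : ({i, j} : Finset ι)ᶜ.card = Fintype.card ι - 2 := by
    rw [Finset.card_compl, hcard2]
  have key := card_pow_mul_sum_le hw hb hb1 hsymm hκ _ {i, j} M
    (fun e : ι → E => F (e i) (e j)) hcard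
    (fun A' h => hM A' (h (by simp)) (h (by simp))) (fun e => hF _ _)
    (fun e v x hv => by
      simp only [Finset.mem_insert, Finset.mem_singleton, not_or] at hv
      rw [Function.update_of_ne (Ne.symm hv.1), Function.update_of_ne (Ne.symm hv.2)])
  have hE : (0 : ℝ) < Fintype.card E := Nat.cast_pos.2 Fintype.card_pos
  have hle : 2 ≤ Fintype.card ι := hcard2 ▸ Finset.card_le_univ _
  have hι : Fintype.card ι = 2 + (Fintype.card ι - 2) := by omega
  have h1 := sum_pair_coordinates (ι := ι) F hij
  rw [hι, pow_add, mul_assoc] at h1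
  rw [mul_left_cancel₀ (pow_pos hE 2).ne' h1, mul_left_comm] at key
  exact le_of_mul_le_mul_left key (pow_pos hE _)

end SpanningTree

/-! ### Bounds for a single diagram. -/

section DiagramBounds

theorem multiset_prod_map_const_mul {α : Type*} (M : Multiset α) (B : ℝ) (d : α → ℝ) :
    (M.map fun p => B * d p).prod = B ^ M.card * (M.map d).prod := by
  rw [Multiset.prod_map_mul, Multiset.map_const', Multiset.prod_replicate]

variable {ι E : Type*} [DecidableEq ι] [Fintype ι] [Fintype E]

/-- The coefficients are exchanged first, against `s`, and then the covariances, against `a'`. -/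
theorem norm_diagram_sum_sub_le {a a' : ι → E → ℂ} {d : ι → E → ℝ} {s s' : E → E → ℂ}
    {t : E → E → ℝ} (ha : ∀ i x, ‖a i x‖ ≤ d i x) (ha' : ∀ i x, ‖a' i x‖ ≤ d i x)
    (hs : ∀ x y, ‖s x y‖ ≤ t x y) (hs' : ∀ x y, ‖s' x y‖ ≤ t x y) (M : Multiset (ι × ι)) :
    ‖∑ e : ι → E, (∏ i, a i (e i)) * (M.map fun p => s (e p.1) (e p.2)).prod -
      ∑ e : ι → E, (∏ i, a' i (e i)) * (M.map fun p => s' (e p.1) (e p.2)).prod‖ ≤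
      ∑ i, ∑ e : ι → E, ‖a i (e i) - a' i (e i)‖ * (∏ j ∈ Finset.univ.erase i, d j (e j)) *
        (M.map fun p => t (e p.1) (e p.2)).prod +
      (M.map fun p => ∑ e : ι → E, (∏ j, d j (e j)) * (‖s (e p.1) (e p.2) - s' (e p.1) (e p.2)‖ *
        ((M.erase p).map fun q => t (e q.1) (e q.2)).prod)).sum := by
  have hpoint (e : ι → E) :
      ‖(∏ i, a i (e i)) * (M.map fun p => s (e p.1) (e p.2)).prod -
        (∏ i, a' i (e i)) * (M.map fun p => s' (e p.1) (e p.2)).prod‖ ≤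
      ∑ i, ‖a i (e i) - a' i (e i)‖ * (∏ j ∈ Finset.univ.erase i, d j (e j)) *
        (M.map fun p => t (e p.1) (e p.2)).prod +
      (M.map fun p => (∏ j, d j (e j)) * (‖s (e p.1) (e p.2) - s' (e p.1) (e p.2)‖ *
        ((M.erase p).map fun q => t (e q.1) (e q.2)).prod)).sum := by
    have h1 : (∏ i, a i (e i)) * (M.map fun p => s (e p.1) (e p.2)).prod -
        (∏ i, a' i (e i)) * (M.map fun p => s' (e p.1) (e p.2)).prod =
        (∏ i, a i (e i) - ∏ i, a' i (e i)) * (M.map fun p => s (e p.1) (e p.2)).prod +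
        (∏ i, a' i (e i)) * ((M.map fun p => s (e p.1) (e p.2)).prod -
          (M.map fun p => s' (e p.1) (e p.2)).prod) := by ring
    rw [h1]
    refine (norm_add_le _ _).trans (add_le_add ?_ ?_)
    · rw [norm_mul, ← Finset.sum_mul]
      exact mul_le_mul (norm_finset_prod_sub_prod_le Finset.univ (fun i => ha i (e i))
        fun i => ha' i (e i)) (norm_multiset_prod_le M fun p => hs _ _) (norm_nonneg _)
        (Finset.sum_nonneg fun i _ => mul_nonneg (norm_nonneg _)
          (Finset.prod_nonneg fun j _ => (norm_nonneg _).trans (ha j (e j))))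
    · rw [norm_mul, Multiset.sum_map_mul_left]
      refine mul_le_mul ?_ (norm_multiset_prod_sub_prod_le M (fun p => hs _ _) fun p => hs' _ _)
        (norm_nonneg _) (Finset.prod_nonneg fun j _ => (norm_nonneg _).trans (ha j (e j)))
      rw [norm_prod]
      exact Finset.prod_le_prod (fun i _ => norm_nonneg _) fun i _ => ha' i (e i)
  rw [← Finset.sum_sub_distrib]
  refine (norm_sum_le _ _).trans ((Finset.sum_le_sum fun e _ => hpoint e).trans_eq ?_)
  rw [Finset.sum_add_distrib, Finset.sum_comm]
  congr 1
  exact Multiset.sum_map_sum_map (Finset.univ : Finset (ι → E)).val M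

variable [Nonempty E] {w : E → ℝ} {b : E → E → ℝ} {κ : ℝ}

/-- At the root `i` the exact sum of `d i` is kept, since only that sum is known to be small;
elsewhere the pointwise bound suffices and each vertex costs `κ`. -/
theorem sum_rooted_le (hw : ∀ x, 0 ≤ w x)
    (hb : ∀ x y, 0 ≤ b x y) (hb1 : ∀ x y, b x y ≤ 1) (hsymm : ∀ x y, b x y = b y x)
    (hκ : ∀ x, ∑ y, w y * b x y ≤ κ) {B : ℝ} (hB : 0 ≤ B) {M : Multiset (ι × ι)} (hM : IsConn M)
    {d : ι → E → ℝ} {G : ι → ℝ} (i : ι) (hG : ∀ j ≠ i, 0 ≤ G j) (hd0 : ∀ j x, 0 ≤ d j x)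
    (hd : ∀ j ≠ i, ∀ x, d j x ≤ G j * w x) :
    ∑ e : ι → E, (∏ j, d j (e j)) * (M.map fun p => B * b (e p.1) (e p.2)).prod ≤
      B ^ M.card * (∏ j ∈ Finset.univ.erase i, G j) * (κ ^ (Fintype.card ι - 1) * ∑ x, d i x) := by
  have hGP : 0 ≤ ∏ j ∈ Finset.univ.erase i, G j :=
    Finset.prod_nonneg fun j hj => hG j (Finset.ne_of_mem_erase hj)
  have hbP (e : ι → E) : 0 ≤ (M.map fun p => b (e p.1) (e p.2)).prod :=
    multiset_prod_nonneg M fun p => hb _ _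
  have hpoint (e : ι → E) :
      (∏ j, d j (e j)) * (M.map fun p => B * b (e p.1) (e p.2)).prod ≤
      B ^ M.card * (∏ j ∈ Finset.univ.erase i, G j) * (d i (e i) *
        (∏ j ∈ Finset.univ.erase i, w (e j)) * (M.map fun p => b (e p.1) (e p.2)).prod) := by
    rw [multiset_prod_map_const_mul, ← Finset.mul_prod_erase _ _ (Finset.mem_univ i)]
    have h1 : ∏ j ∈ Finset.univ.erase i, d j (e j) ≤
        (∏ j ∈ Finset.univ.erase i, G j) * ∏ j ∈ Finset.univ.erase i, w (e j) := by
      rw [← Finset.prod_mul_distrib]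
      exact Finset.prod_le_prod (fun j _ => hd0 j _)
        fun j hj => hd j (Finset.ne_of_mem_erase hj) _
    have h2 := mul_le_mul_of_nonneg_left h1
      (mul_nonneg (hd0 i (e i)) (mul_nonneg (pow_nonneg hB M.card) (hbP e)))
    linarith [h2]
  refine (Finset.sum_le_sum fun e _ => hpoint e).trans ?_
  rw [← Finset.mul_sum]
  exact mul_le_mul_of_nonneg_left (sum_le_of_root hw hb hb1 hsymm hκ i M
    (fun A hA hA1 => hM.exists_crossing ⟨i, hA⟩ hA1) (hd0 i)) (mul_nonneg (pow_nonneg hB _) hGP)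

/-- The edge `p` carrying the difference `D` is deleted and its ends serve as roots. A set
containing both ends is still crossed by another edge. `hT1` covers a loop, `hT2` two distinct ends.
-/
theorem sum_edge_le (hw : ∀ x, 0 ≤ w x)
    (hb : ∀ x y, 0 ≤ b x y) (hb1 : ∀ x y, b x y ≤ 1) (hsymm : ∀ x y, b x y = b y x)
    (hκ : ∀ x, ∑ y, w y * b x y ≤ κ) {B : ℝ} (hB : 1 ≤ B) {M : Multiset (ι × ι)} (hM : IsConn M)
    {d : ι → E → ℝ} {G : ι → ℝ} (hG : ∀ j, 0 ≤ G j) (hd0 : ∀ j x, 0 ≤ d j x)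
    (hd : ∀ j x, d j x ≤ G j * w x) {D : E → E → ℝ} (hD : ∀ x y, 0 ≤ D x y) {T : ℝ}
    (hT1 : κ ^ (Fintype.card ι - 1) * ∑ x, D x x * w x ≤ T)
    (hT2 : 2 ≤ Fintype.card ι →
      κ ^ (Fintype.card ι - 2) * ∑ x, ∑ y, D x y * (w x * w y) ≤ T)
    {p : ι × ι} (hp : p ∈ M) :
    ∑ e : ι → E, (∏ j, d j (e j)) * (D (e p.1) (e p.2) *
        ((M.erase p).map fun q => B * b (e q.1) (e q.2)).prod) ≤
      B ^ M.card * (∏ j, G j) * T := by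
  have hbP (e : ι → E) : 0 ≤ ((M.erase p).map fun p => b (e p.1) (e p.2)).prod :=
    multiset_prod_nonneg _ fun p => hb _ _
  have hGP : 0 ≤ ∏ j, G j := Finset.prod_nonneg fun j _ => hG j
  have hpow : B ^ (M.erase p).card ≤ B ^ M.card :=
    pow_le_pow_right₀ hB (Multiset.card_le_card (Multiset.erase_le _ _))
  have hB0 : 0 ≤ B := zero_le_one.trans hB
  have hpoint (e : ι → E) :
      (∏ j, d j (e j)) * (D (e p.1) (e p.2) *
        ((M.erase p).map fun q => B * b (e q.1) (e q.2)).prod) ≤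
      B ^ M.card * (∏ j, G j) * (D (e p.1) (e p.2) * (∏ j, w (e j)) *
        ((M.erase p).map fun p => b (e p.1) (e p.2)).prod) := by
    rw [multiset_prod_map_const_mul]
    have h1 : ∏ j, d j (e j) ≤ (∏ j, G j) * ∏ j, w (e j) := by
      rw [← Finset.prod_mul_distrib]
      exact Finset.prod_le_prod (fun j _ => hd0 j _) fun j _ => hd j _
    have h0 : 0 ≤ ∏ j, w (e j) := Finset.prod_nonneg fun j _ => hw _
    have h2 := mul_le_mul h1 hpow (pow_nonneg hB0 _) (mul_nonneg hGP h0)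
    have h3 := mul_le_mul_of_nonneg_right h2 (mul_nonneg (hD (e p.1) (e p.2)) (hbP e))
    linarith [h3]
  refine (Finset.sum_le_sum fun e _ => hpoint e).trans ?_
  rw [← Finset.mul_sum]
  refine mul_le_mul_of_nonneg_left ?_ (mul_nonneg (pow_nonneg hB0 _) hGP)
  obtain ⟨i, j⟩ := p
  have hcross (A : Finset ι) (hi : i ∈ A) (hj : j ∈ A) (hA : A ≠ Finset.univ) :
      Crosses (M.erase (i, j)) A :=
    Crosses.erase (hM.exists_crossing ⟨i, hi⟩ hA) hi hj
  by_cases hij : i = j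
  · subst hij
    have := sum_le_of_root hw hb hb1 hsymm hκ i (M.erase (i, i)) (F := fun x => D x x * w x)
      (fun A hi hA => hcross A hi hi hA) (fun x => mul_nonneg (hD _ _) (hw _))
    refine le_trans (Finset.sum_le_sum fun e _ => le_of_eq ?_) (this.trans hT1)
    rw [← Finset.mul_prod_erase _ _ (Finset.mem_univ i)]
    ring
  · have := sum_le_of_root_edge hw hb hb1 hsymm hκ hij (M.erase (i, j))
      (F := fun x y => D x y * (w x * w y)) hcross
      (fun x y => mul_nonneg (hD _ _) (mul_nonneg (hw _) (hw _)))
    have hcard : 2 ≤ Fintype.card ι := Finset.card_pair hij ▸ Finset.card_le_univ _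
    refine le_trans (Finset.sum_le_sum fun e _ => le_of_eq ?_) (this.trans (hT2 hcard))
    rw [← Finset.prod_mul_prod_compl {i, j}, Finset.prod_pair hij]
    ring

end DiagramBounds

/-! ### Weights and kernel on pairs of indices. -/

section PairWeights

variable {n : ℕ}

open Classical in
/-- The weight `n` for diagonal pairs and `1` for the others. -/
noncomputable def pairWeight (e : Sym2 (Fin n)) : ℝ := if e.IsDiag then n else 1

open Classical in
/-- The kernel that is `1` for intersecting pairs and `1 / n` for disjoint ones. -/
noncomputable def pairKernel (e f : Sym2 (Fin n)) : ℝ := if Meets e f then 1 else (n : ℝ)⁻¹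

theorem Meets.symm {e f : Sym2 (Fin n)} (h : Meets e f) : Meets f e :=
  let ⟨v, h1, h2⟩ := h
  ⟨v, h2, h1⟩

theorem meets_self (e : Sym2 (Fin n)) : Meets e e := by
  induction e using Sym2.ind with
  | _ a b => exact ⟨a, by simp, by simp⟩

theorem pairWeight_map (g : Equiv.Perm (Fin n)) (e : Sym2 (Fin n)) :
    pairWeight (e.map g) = pairWeight e := by
  simp only [pairWeight, Sym2.isDiag_map g.injective]

theorem pairKernel_symm (e f : Sym2 (Fin n)) : pairKernel e f = pairKernel f e := by
  have : Meets e f ↔ Meets f e := ⟨Meets.symm, Meets.symm⟩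
  by_cases h : Meets f e <;> simp [pairKernel, this, h]

theorem pairKernel_self (e : Sym2 (Fin n)) : pairKernel e e = 1 := if_pos (meets_self e)

theorem pairKernel_nonneg (e f : Sym2 (Fin n)) : 0 ≤ pairKernel e f := by
  rw [pairKernel]; split_ifs <;> positivity

theorem pairKernel_le_one (e f : Sym2 (Fin n)) : pairKernel e f ≤ 1 := by
  rw [pairKernel]; split_ifs
  · exact le_rfl
  · exact Nat.cast_inv_le_one n

theorem pairWeight_nonneg (e : Sym2 (Fin n)) : 0 ≤ pairWeight e := by
  rw [pairWeight]; split_ifs <;> positivity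

theorem sum_pairWeight_mem_le (a : Fin n) :
    ∑ f : Sym2 (Fin n) with a ∈ f, pairWeight f ≤ 2 * n := by
  have himg : (Finset.univ.filter fun f : Sym2 (Fin n) => a ∈ f) =
      Finset.univ.image fun k => s(a, k) := by
    ext f
    simp [Sym2.mem_iff_exists, eq_comm]
  rw [himg, Finset.sum_image fun k _ k' _ h => Sym2.congr_right.1 h]
  calc ∑ k, pairWeight s(a, k) ≤ ∑ k, ((if a = k then (n : ℝ) else 0) + 1) := by
        refine Finset.sum_le_sum fun k _ => ?_
        simp only [pairWeight, Sym2.mk_isDiag_iff]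
        split_ifs <;> simp
    _ = 2 * n := by
        rw [Finset.sum_add_distrib]
        simp
        ring

theorem sum_pairWeight_le : ∑ f : Sym2 (Fin n), pairWeight f ≤ 2 * (n : ℝ) ^ 2 := by
  calc ∑ f : Sym2 (Fin n), pairWeight f
      ≤ ∑ f : Sym2 (Fin n), ∑ a : Fin n, if a ∈ f then pairWeight f else 0 := by
        refine Finset.sum_le_sum fun f _ => ?_
        obtain ⟨a, ha, -⟩ := meets_self f
        refine le_trans (le_of_eq (if_pos ha).symm) (Finset.single_le_sum
          (f := fun a => if a ∈ f then pairWeight f else 0) (fun a _ => ?_) (Finset.mem_univ a))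
        split_ifs
        exacts [pairWeight_nonneg f, le_rfl]
    _ = ∑ a : Fin n, ∑ f : Sym2 (Fin n) with a ∈ f, pairWeight f := by
        rw [Finset.sum_comm]
        simp_rw [Finset.sum_filter]
    _ ≤ ∑ _a : Fin n, 2 * (n : ℝ) := Finset.sum_le_sum fun a _ => sum_pairWeight_mem_le a
    _ = 2 * (n : ℝ) ^ 2 := by simp; ring

/-- Pairs meeting `s(a, b)` contain `a` or `b`, with total weight at most `2n` each; the rest
contribute at most `2n²` times `1/n`. -/
theorem sum_pairWeight_mul_pairKernel_le (hn : 1 ≤ n) (e : Sym2 (Fin n)) :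
    ∑ f, pairWeight f * pairKernel e f ≤ 6 * n := by
  induction e using Sym2.ind with
  | _ a b =>
    have hn0 : (0 : ℝ) < n := by exact_mod_cast hn
    have hpoint (f : Sym2 (Fin n)) : pairWeight f * pairKernel s(a, b) f ≤
        (if a ∈ f then pairWeight f else 0) + (if b ∈ f then pairWeight f else 0) +
          pairWeight f * (n : ℝ)⁻¹ := by
      have h0 := pairWeight_nonneg f
      have h1 : 0 ≤ pairWeight f * (n : ℝ)⁻¹ := by positivity
      have ha : 0 ≤ if a ∈ f then pairWeight f else 0 := by split_ifs <;> simp [h0]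
      have hb : 0 ≤ if b ∈ f then pairWeight f else 0 := by split_ifs <;> simp [h0]
      by_cases h : Meets s(a, b) f
      · rw [pairKernel, if_pos h, mul_one]
        obtain ⟨v, hv, hvf⟩ := h
        rcases Sym2.mem_iff.1 hv with rfl | rfl
        · rw [if_pos hvf] at ha ⊢; linarith
        · rw [if_pos hvf] at hb ⊢; linarith
      · rw [pairKernel, if_neg h]; linarith
    refine (Finset.sum_le_sum fun f _ => hpoint f).trans ?_
    rw [Finset.sum_add_distrib, Finset.sum_add_distrib, ← Finset.sum_filter, ← Finset.sum_filter,
      ← Finset.sum_mul]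
    have h1 := sum_pairWeight_mem_le a
    have h2 := sum_pairWeight_mem_le b
    have h3 : (∑ f : Sym2 (Fin n), pairWeight f) * (n : ℝ)⁻¹ ≤ 2 * n := by
      rw [← div_eq_mul_inv, div_le_iff₀ hn0]
      linarith [sum_pairWeight_le (n := n)]
    linarith

/-- A weighted sum of covariance differences is controlled by the averages over permutations,
when the weights are invariant under permutations. -/
theorem sum_mul_le_of_covDiffBound {μ : ℝ} {σ σ' : Sym2 (Fin n) → Sym2 (Fin n) → ℝ}
    (h : CovDiffBound μ σ σ') {W : Sym2 (Fin n) → Sym2 (Fin n) → ℝ} (hW0 : ∀ e f, 0 ≤ W e f)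
    (hW : ∀ (g : Equiv.Perm (Fin n)) e f, W (e.map g) (f.map g) = W e f) :
    ∑ e, ∑ f, W e f * |σ e f - σ' e f| ≤ μ * ∑ e, ∑ f, W e f * pairKernel e f := by
  have hg (g : Equiv.Perm (Fin n)) : ∑ e, ∑ f, W e f * |σ e f - σ' e f| =
      ∑ e, ∑ f, W e f * |σ (e.map g) (f.map g) - σ' (e.map g) (f.map g)| := by
    have hbij : Function.Bijective (Sym2.map g) := 
      Finite.injective_iff_bijective.1 (Sym2.map.injective g.injective)
    refine (Fintype.sum_bijective _ hbij _ _ fun e => ?_).symm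
    refine Fintype.sum_bijective _ hbij _ _ fun f => ?_
    rw [hW]
  have hfac : (0 : ℝ) < n.factorial := by exact_mod_cast n.factorial_pos
  -- Relabelling by any `g` leaves the sum unchanged, so it equals its average over `g`.
  have havg : ∑ e, ∑ f, W e f * |σ e f - σ' e f| =
      ∑ e, ∑ f, W e f * ((n.factorial : ℝ)⁻¹ * ∑ g : Equiv.Perm (Fin n),
        |σ (e.map g) (f.map g) - σ' (e.map g) (f.map g)|) := by
    have h1 : ∑ _g : Equiv.Perm (Fin n), ∑ e, ∑ f, W e f * |σ e f - σ' e f| =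
        n.factorial * ∑ e, ∑ f, W e f * |σ e f - σ' e f| := by
      simp [Fintype.card_perm]
    rw [← mul_right_inj' hfac.ne', ← h1, Finset.sum_congr rfl fun g _ => hg g,
      Finset.sum_comm, Finset.mul_sum]
    refine Finset.sum_congr rfl fun e _ => ?_
    rw [Finset.sum_comm, Finset.mul_sum]
    refine Finset.sum_congr rfl fun f _ => ?_
    rw [← Finset.mul_sum]
    field_simp
  rw [havg, Finset.mul_sum]
  refine Finset.sum_le_sum fun e _ => ?_
  rw [Finset.mul_sum]
  refine Finset.sum_le_sum fun f _ => ?_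
  rw [mul_left_comm μ]
  refine mul_le_mul_of_nonneg_left ?_ (hW0 e f)
  rw [pairKernel]
  split_ifs with hm
  · simpa using (h e f).1 hm
  · simpa [div_eq_mul_inv] using (h e f).2 hm

theorem CovDiffBound.nonneg {μ : ℝ} {σ σ' : Sym2 (Fin n) → Sym2 (Fin n) → ℝ}
    (h : CovDiffBound μ σ σ') (hn : 1 ≤ n) : 0 ≤ μ := by
  have : 0 ≤ (n.factorial : ℝ)⁻¹ * ∑ g : Equiv.Perm (Fin n),
      |σ (s(⟨0, hn⟩, ⟨0, hn⟩).map g) (s(⟨0, hn⟩, ⟨0, hn⟩).map g) -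
        σ' (s(⟨0, hn⟩, ⟨0, hn⟩).map g) (s(⟨0, hn⟩, ⟨0, hn⟩).map g)| := by positivity
  exact this.trans ((h _ _).1 (meets_self _))

/-- Serves for loops of a diagram; the invariant weight is supported on `e = f`. -/
theorem sum_diag_covDiff_le {μ : ℝ} {σ σ' : Sym2 (Fin n) → Sym2 (Fin n) → ℝ}
    (h : CovDiffBound μ σ σ') (hn : 1 ≤ n) :
    ∑ e, |σ e e - σ' e e| * pairWeight e ≤ 2 * (n : ℝ) ^ 2 * μ := by
  classical
  have key := sum_mul_le_of_covDiffBound h (W := fun e f => if e = f then pairWeight e else 0)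
    (fun e f => by split_ifs; exacts [pairWeight_nonneg e, le_rfl])
    (fun g e f => by simp only [(Sym2.map.injective g.injective).eq_iff, pairWeight_map])
  simp only [ite_mul, zero_mul, Finset.sum_ite_eq, Finset.mem_univ, if_true, pairKernel_self,
    mul_one] at key
  simp_rw [mul_comm (|_|)]
  refine key.trans ?_
  rw [mul_comm]
  exact mul_le_mul_of_nonneg_right sum_pairWeight_le (h.nonneg hn)

theorem sum_covDiff_le {μ : ℝ} {σ σ' : Sym2 (Fin n) → Sym2 (Fin n) → ℝ}
    (h : CovDiffBound μ σ σ') (hn : 1 ≤ n) :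
    ∑ e, ∑ f, |σ e f - σ' e f| * (pairWeight e * pairWeight f) ≤ 12 * (n : ℝ) ^ 3 * μ := by
  have key := sum_mul_le_of_covDiffBound h (W := fun e f => pairWeight e * pairWeight f)
    (fun e f => mul_nonneg (pairWeight_nonneg e) (pairWeight_nonneg f))
    (fun g e f => by simp only [pairWeight_map])
  simp_rw [mul_comm (|_|)]
  refine key.trans ?_
  rw [mul_comm]
  refine mul_le_mul_of_nonneg_right ?_ (h.nonneg hn)
  have hn0 : (0 : ℝ) ≤ n := Nat.cast_nonneg n
  calc ∑ e, ∑ f, pairWeight e * pairWeight f * pairKernel e f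
      = ∑ e : Sym2 (Fin n), pairWeight e * ∑ f, pairWeight f * pairKernel e f := by
        simp_rw [Finset.mul_sum, mul_assoc]
    _ ≤ ∑ e : Sym2 (Fin n), pairWeight e * (6 * n) := Finset.sum_le_sum fun e _ =>
        mul_le_mul_of_nonneg_left (sum_pairWeight_mul_pairKernel_le hn e) (pairWeight_nonneg e)
    _ = (∑ e : Sym2 (Fin n), pairWeight e) * (6 * n) := by rw [Finset.sum_mul]
    _ ≤ 2 * (n : ℝ) ^ 2 * (6 * n) := mul_le_mul_of_nonneg_right sum_pairWeight_le (by positivity)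
    _ = 12 * (n : ℝ) ^ 3 := by ring

end PairWeights

/-! ### Bounds for the coefficients. -/

section Coefficients

variable {n L : ℕ} {C : ℕ → ℝ} {c c' : ℕ → Sym2 (Fin n) → ℂ}

theorem CoeffBounds.nonneg (h : CoeffBounds L C c) (hn : 2 ≤ n) {ℓ : ℕ} (h1 : 1 ≤ ℓ)
    (hL : ℓ ≤ L) : 0 ≤ C ℓ := by
  have h01 : (⟨0, by omega⟩ : Fin n) < ⟨1, by omega⟩ := by simp
  obtain rfl | rfl | h3 : ℓ = 1 ∨ ℓ = 2 ∨ 3 ≤ ℓ := by omega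
  · have hn0 : (0 : ℝ) < n := by exact_mod_cast (by omega : 0 < n)
    exact nonneg_of_mul_nonneg_right ((norm_nonneg _).trans (h.linear ⟨0, by omega⟩)) hn0
  · exact (norm_nonneg _).trans (h.quadratic_offDiag _ _ h01)
  · exact (norm_nonneg _).trans (h.higher ℓ h3 hL _ _ h01)

theorem exists_lt_of_not_isDiag {e : Sym2 (Fin n)} (he : ¬ e.IsDiag) :
    ∃ j k : Fin n, j < k ∧ e = s(j, k) := by
  induction e using Sym2.ind with
  | _ a b =>
    rw [Sym2.mk_isDiag_iff] at he
    rcases lt_or_gt_of_ne he with h | h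
    · exact ⟨a, b, h, rfl⟩
    · exact ⟨b, a, h, Sym2.eq_swap⟩

theorem exists_eq_of_isDiag {e : Sym2 (Fin n)} (he : e.IsDiag) : ∃ j : Fin n, e = s(j, j) := by
  induction e using Sym2.ind with
  | _ a b =>
    rw [Sym2.mk_isDiag_iff] at he
    exact ⟨a, by rw [he]⟩

theorem CoeffBounds.norm_redCoeff_le (h : CoeffBounds L C c) (hn : 2 ≤ n) {ℓ : ℕ} (h1 : 1 ≤ ℓ)
    (hL : ℓ ≤ L) (e : Sym2 (Fin n)) : ‖redCoeff c ℓ e‖ ≤ C ℓ * pairWeight e := by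
  have h0 : 0 ≤ C ℓ * pairWeight e := mul_nonneg (h.nonneg hn h1 hL) (pairWeight_nonneg e)
  rw [redCoeff]
  split_ifs with hc
  swap
  · simpa using h0
  by_cases he : e.IsDiag
  · rw [pairWeight, if_pos he, mul_comm]
    obtain ⟨j, rfl⟩ := exists_eq_of_isDiag he
    rcases hc with rfl | hc
    · exact h.quadratic_diag j
    · rw [hc.2 he]
      exact h.linear j
  · rw [pairWeight, if_neg he, mul_one]
    obtain ⟨j, k, hjk, rfl⟩ := exists_lt_of_not_isDiag he
    rcases hc with rfl | hc
    · exact h.quadratic_offDiag j k hjk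
    · rcases (by omega : ℓ = 1 ∨ ℓ = 2 ∨ 3 ≤ ℓ) with rfl | rfl | h3
      · exact absurd (hc.1 rfl) he
      · exact h.quadratic_offDiag j k hjk
      · exact h.higher ℓ h3 hL j k hjk

variable {m : ℕ → ℝ} {m1' : ℝ}

theorem sum_eq_sum_diag_add {R : Type*} [AddCommMonoid R] (g : Sym2 (Fin n) → R) :
    ∑ e, g e = ∑ j : Fin n, g s(j, j) + ∑ e : Sym2 (Fin n) with ¬ e.IsDiag, g e := by
  rw [← sum_isDiag, Finset.sum_filter_add_sum_filter_not]

/-- The factor `2` comes from `ℓ = 2`, where diagonal and off-diagonal sums are bounded separately.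
-/
theorem CoeffDiffBounds.sum_norm_redCoeff_sub_le (h : CoeffDiffBounds L C m m1' c c') {ℓ : ℕ}
    (h1 : 1 ≤ ℓ) (hL : ℓ ≤ L) :
    ∑ e, ‖redCoeff c ℓ e - redCoeff c' ℓ e‖ ≤ 2 * (n : ℝ) ^ 2 * (m ℓ * C ℓ) := by
  have hnn : ∀ {T : Finset (Sym2 (Fin n))} {g : Sym2 (Fin n) → ℂ}, 0 ≤ ∑ e ∈ T, ‖g e‖ :=
    Finset.sum_nonneg fun _ _ => norm_nonneg _
  rw [sum_eq_sum_diag_add]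
  obtain rfl | rfl | h3 : ℓ = 1 ∨ ℓ = 2 ∨ 3 ≤ ℓ := by omega
  · have hoff : ∑ e : Sym2 (Fin n) with ¬ e.IsDiag, ‖redCoeff c 1 e - redCoeff c' 1 e‖ = 0 := by
      refine Finset.sum_eq_zero fun e he => ?_
      have := (Finset.mem_filter.1 he).2
      simp [redCoeff, this]
    have hl := h.linear
    have h0 : 0 ≤ ∑ j : Fin n, ‖c 1 s(j, j) - c' 1 s(j, j)‖ :=
      Finset.sum_nonneg fun _ _ => norm_nonneg _
    rw [hoff, add_zero]
    simp only [redCoeff, Sym2.mk_isDiag_iff, or_true, if_true, iff_self]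
    linarith
  · simp only [redCoeff, true_or, if_true]
    linarith [h.quadratic_diag, h.offDiag 2 le_rfl hL]
  · have hd : ∑ j : Fin n, ‖redCoeff c ℓ s(j, j) - redCoeff c' ℓ s(j, j)‖ = 0 := by
      refine Finset.sum_eq_zero fun j _ => ?_
      have h1 : ℓ ≠ 1 := by omega
      have h2 : ℓ ≠ 2 := by omega
      simp [redCoeff, h1, h2]
    have hoff : ∑ e : Sym2 (Fin n) with ¬ e.IsDiag, ‖redCoeff c ℓ e - redCoeff c' ℓ e‖ =
        ∑ e : Sym2 (Fin n) with ¬ e.IsDiag, ‖c ℓ e - c' ℓ e‖ := by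
      refine Finset.sum_congr rfl fun e he => ?_
      have h1 : ℓ ≠ 1 := by omega
      have he := (Finset.mem_filter.1 he).2
      simp [redCoeff, h1, he]
    have hl := h.offDiag ℓ (by omega) hL
    have h0 : 0 ≤ ∑ e : Sym2 (Fin n) with ¬ e.IsDiag, ‖c ℓ e - c' ℓ e‖ := hnn
    rw [hd, hoff, zero_add]
    linarith

/-- `A` is the largest difference of linear coefficients; it is divided by `n` because `pairWeight`
is `n` on the diagonal. -/
theorem CoeffDiffBounds.exists_linear_bound (h : CoeffDiffBounds L C m m1' c c') (hn : 2 ≤ n) :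
    ∃ A : ℝ, 0 ≤ A ∧ (∀ e, ‖redCoeff c 1 e - redCoeff c' 1 e‖ ≤ A / n * pairWeight e) ∧
      A * ∑ e, (‖redCoeff c 1 e‖ + ‖redCoeff c' 1 e‖) ≤ m1' * (n : ℝ) ^ 3 * C 1 ^ 2 := by
  have hn0 : (0 : ℝ) < n := by exact_mod_cast (by omega : 0 < n)
  have hne : (Finset.univ : Finset (Fin n)).Nonempty := ⟨⟨0, by omega⟩, Finset.mem_univ _⟩
  obtain ⟨j, -, hj⟩ := Finset.exists_max_image Finset.univ
    (fun j : Fin n => ‖c 1 s(j, j) - c' 1 s(j, j)‖) hne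
  refine ⟨_, norm_nonneg (c 1 s(j, j) - c' 1 s(j, j)), fun e => ?_, ?_⟩
  · by_cases he : e.IsDiag
    · rw [pairWeight, if_pos he, div_mul_cancel₀ _ hn0.ne']
      obtain ⟨k, rfl⟩ := exists_eq_of_isDiag he
      simpa [redCoeff] using hj k (Finset.mem_univ k)
    · have : redCoeff c 1 e - redCoeff c' 1 e = 0 := by simp [redCoeff, he]
      rw [this, norm_zero]
      exact mul_nonneg (by positivity) (pairWeight_nonneg e)
  · rw [sum_eq_sum_diag_add, Finset.sum_eq_zero (s := Finset.univ.filter _), add_zero]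
    · simpa [redCoeff] using h.linear' j
    · intro e he
      simp [redCoeff, (Finset.mem_filter.1 he).2]

end Coefficients

/-! ### The bound for one tuple of degrees, and the theorem. -/

section TupleBound

variable {n : ℕ} {Ω : Type*} [MeasurableSpace Ω] {P : Measure Ω} {B : ℝ}

theorem IsGaussianFamily.norm_cov_le {Y : Sym2 (Fin n) → Ω → ℝ} (h : IsGaussianFamily P B Y)
    (e f : Sym2 (Fin n)) :
    ‖((cov[Y e, Y f; P] : ℝ) : ℂ)‖ ≤ max 1 B * pairKernel e f := by
  rw [Complex.norm_real, Real.norm_eq_abs, pairKernel]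
  split_ifs with hm
  · rw [mul_one]
    exact (h.cov_meets e f hm).trans (le_max_right _ _)
  · refine (h.cov_disjoint e f hm).trans ?_
    rw [div_eq_mul_inv]
    exact mul_le_mul_of_nonneg_right (le_max_right _ _) (by positivity)

theorem prod_erase_univ_two_mul {r : ℕ} (i : Fin r) (C : Fin r → ℝ) :
    ∏ j ∈ Finset.univ.erase i, 2 * C j = 2 ^ (r - 1) * ∏ j ∈ Finset.univ.erase i, C j := by
  rw [Finset.prod_mul_distrib, Finset.prod_const, Finset.card_erase_of_mem (Finset.mem_univ i)]
  simp

/-- The contribution to the difference of two cumulants of a single connected diagram. -/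
theorem norm_diagram_sum_sub_le_boundTerm {r L : ℕ} (hn : 2 ≤ n) {C m : ℕ → ℝ} {m1' μ : ℝ}
    {c c' : ℕ → Sym2 (Fin n) → ℂ} {σ σ' : Sym2 (Fin n) → Sym2 (Fin n) → ℝ}
    (hc : CoeffBounds L C c) (hc' : CoeffBounds L C c') {B₁ : ℝ} (hB : 1 ≤ B₁)
    (hσ : ∀ e f, ‖(σ e f : ℂ)‖ ≤ B₁ * pairKernel e f)
    (hσ' : ∀ e f, ‖(σ' e f : ℂ)‖ ≤ B₁ * pairKernel e f)
    (hμ : CovDiffBound μ σ σ') (hm : CoeffDiffBounds L C m m1' c c')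
    {S : Finset (Fin r → ℕ)} (hS : ∀ ℓ ∈ S, 2 ≤ (Finset.univ.filter fun i => ℓ i = 1).card)
    {ℓ : Fin r → ℕ} (hℓ : ∀ i, 1 ≤ ℓ i ∧ ℓ i ≤ L) {M : Multiset (Fin r × Fin r)} (hM : IsConn M) :
    ‖∑ e : Fin r → Sym2 (Fin n), (∏ i, redCoeff c (ℓ i) (e i)) *
        (M.map fun p => (σ (e p.1) (e p.2) : ℂ)).prod -
      ∑ e : Fin r → Sym2 (Fin n), (∏ i, redCoeff c' (ℓ i) (e i)) *
        (M.map fun p => (σ' (e p.1) (e p.2) : ℂ)).prod‖ ≤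
      B₁ ^ M.card * 12 ^ r * (r + M.card) * (n : ℝ) ^ (r + 1) * boundTerm C m m1' μ S ℓ := by
  have hn1 : 1 ≤ n := by omega
  have hn0 : (0 : ℝ) < n := by exact_mod_cast hn1
  have : Nonempty (Sym2 (Fin n)) := ⟨s(⟨0, hn1⟩, ⟨0, hn1⟩)⟩
  have hB0 : 0 ≤ B₁ := zero_le_one.trans hB
  have hC (i : Fin r) : 0 ≤ C (ℓ i) := hc.nonneg hn (hℓ i).1 (hℓ i).2
  set w : Sym2 (Fin n) → ℝ := pairWeight with hw
  -- A common majorant of both coefficient families; the sum of norms is what the hypothesis on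
  -- `m1'` involves.
  set d : Fin r → Sym2 (Fin n) → ℝ :=
    fun i x => ‖redCoeff c (ℓ i) x‖ + ‖redCoeff c' (ℓ i) x‖ with hd
  set G : Fin r → ℝ := fun i => 2 * C (ℓ i) with hG
  set mt : ℕ → ℝ := fun j => if j = 1 ∧ ℓ ∈ S then m1' else m j with hmt
  have hd0 (j : Fin r) (x : Sym2 (Fin n)) : 0 ≤ d j x := by positivity
  have hG0 (j : Fin r) : 0 ≤ G j := mul_nonneg zero_le_two (hC j)
  have hdG (j : Fin r) (x : Sym2 (Fin n)) : d j x ≤ G j * w x := by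
    have h1 := hc.norm_redCoeff_le hn (hℓ j).1 (hℓ j).2 x
    have h2 := hc'.norm_redCoeff_le hn (hℓ j).1 (hℓ j).2 x
    simp only [hd, hG]
    linarith
  have hκ := sum_pairWeight_mul_pairKernel_le hn1
  set PC := ∏ i, C (ℓ i) with hPC
  have hPC0 : 0 ≤ PC := Finset.prod_nonneg fun i _ => hC i
  have hμ0 : 0 ≤ μ := hμ.nonneg hn1
  -- the contributions of differences of coefficients
  have hlin (i : Fin r) : 0 ≤ PC * mt (ℓ i) ∧
      ∑ e : Fin r → Sym2 (Fin n), ‖redCoeff c (ℓ i) (e i) - redCoeff c' (ℓ i) (e i)‖ *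
        (∏ j ∈ Finset.univ.erase i, d j (e j)) *
        (M.map fun p => B₁ * pairKernel (e p.1) (e p.2)).prod ≤
      B₁ ^ M.card * 12 ^ r * (n : ℝ) ^ (r + 1) * (PC * mt (ℓ i)) := by
    set f : Sym2 (Fin n) → ℝ := fun x => ‖redCoeff c (ℓ i) x - redCoeff c' (ℓ i) x‖ with hf
    set d' : Fin r → Sym2 (Fin n) → ℝ := Function.update d i f with hd'
    have hprod (e : Fin r → Sym2 (Fin n)) :
        f (e i) * (∏ j ∈ Finset.univ.erase i, d j (e j)) = ∏ j, d' j (e j) := by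
      rw [← Finset.mul_prod_erase _ _ (Finset.mem_univ i), hd', Function.update_self]
      congr 1
      exact Finset.prod_congr rfl fun j hj => by
        rw [Function.update_of_ne (Finset.ne_of_mem_erase hj)]
    have hd'0 (j : Fin r) (x : Sym2 (Fin n)) : 0 ≤ d' j x := by
      rw [hd']
      by_cases hj : j = i
      · subst hj
        rw [Function.update_self]
        exact norm_nonneg _
      · rw [Function.update_of_ne hj]
        exact hd0 j x
    have hr : r = r - 1 + 1 := by have := i.2; omega
    by_cases hprime : ℓ i = 1 ∧ ℓ ∈ S
    · have hmti : mt (ℓ i) = m1' := if_pos hprime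
      -- The tree is rooted at a second linear vertex `i'`. The difference at `i` is bounded
      -- pointwise by `A / n` times the weight, and `A` then multiplies the sum at the root.
      obtain ⟨i', hi', hne⟩ := Finset.exists_mem_ne (hS ℓ hprime.2) i
      have hi'1 : ℓ i' = 1 := (Finset.mem_filter.1 hi').2
      obtain ⟨A, hA0, hA, hAsum⟩ := hm.exists_linear_bound hn
      set G' : Fin r → ℝ := Function.update G i (A / n) with hG'
      have hG'0 (j : Fin r) : 0 ≤ G' j := by
        rw [hG']
        by_cases hj : j = i
        · subst hj
          rw [Function.update_self]
          positivity
        · rw [Function.update_of_ne hj]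
          exact hG0 j
      have hd'G' (j : Fin r) (x : Sym2 (Fin n)) : d' j x ≤ G' j * w x := by
        rw [hd', hG']
        by_cases hj : j = i
        · subst hj
          rw [Function.update_self, Function.update_self, hf, hprime.1]
          exact hA x
        · rw [Function.update_of_ne hj, Function.update_of_ne hj]
          exact hdG j x
      have key := sum_rooted_le pairWeight_nonneg pairKernel_nonneg pairKernel_le_one
        pairKernel_symm hκ hB0 hM i' (fun j _ => hG'0 j) hd'0 (fun j _ => hd'G' j)
      have hmem : i ∈ Finset.univ.erase i' :=
        Finset.mem_erase.2 ⟨Ne.symm hne, Finset.mem_univ i⟩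
      set Q := ∏ j ∈ (Finset.univ.erase i').erase i, C (ℓ j) with hQ
      have hQ0 : 0 ≤ Q := Finset.prod_nonneg fun j _ => hC j
      have hPCQ : PC = C 1 ^ 2 * Q := by
        rw [hPC, ← Finset.mul_prod_erase _ _ (Finset.mem_univ i'),
          ← Finset.mul_prod_erase _ _ hmem, hprime.1, hi'1]
        ring
      have hGQ : ∏ j ∈ Finset.univ.erase i', G' j = A / n * (2 ^ (r - 2) * Q) := by
        rw [← Finset.mul_prod_erase _ _ hmem, hG', Function.update_self]
        congr 1
        rw [Finset.prod_congr rfl fun j hj =>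
          Function.update_of_ne (Finset.ne_of_mem_erase hj) (A / n) G, hG,
          Finset.prod_mul_distrib, Finset.prod_const, Finset.card_erase_of_mem hmem,
          Finset.card_erase_of_mem (Finset.mem_univ i'), Finset.card_univ, Fintype.card_fin,
          Nat.sub_sub]
      have hsum : ∑ x, d' i' x = ∑ x, (‖redCoeff c 1 x‖ + ‖redCoeff c' 1 x‖) := by
        simp only [hd', Function.update_of_ne hne, hd, hi'1]
      have hAs0 : 0 ≤ A * ∑ x, (‖redCoeff c 1 x‖ + ‖redCoeff c' 1 x‖) :=
        mul_nonneg hA0 (Finset.sum_nonneg fun x _ => by positivity)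
      -- No sign of `m1'` is assumed; it is forced up to the factor `C 1 ^ 2`, because the quantity
      -- bounded is nonnegative.
      have hmC : 0 ≤ m1' * C 1 ^ 2 := by
        have h1 := hAs0.trans hAsum
        have h2 : m1' * (n : ℝ) ^ 3 * C 1 ^ 2 = (n : ℝ) ^ 3 * (m1' * C 1 ^ 2) := by ring
        rw [h2] at h1
        exact nonneg_of_mul_nonneg_right h1 (by positivity)
      have hnn : 0 ≤ PC * mt (ℓ i) := by
        rw [hPCQ, hmti]
        have := mul_nonneg hmC hQ0
        linarith
      refine ⟨hnn, ?_⟩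
      refine (Finset.sum_congr rfl fun e _ => by rw [← hprod]).trans_le (key.trans ?_)
      rw [hGQ, hsum, Fintype.card_fin]
      set s := ∑ x, (‖redCoeff c 1 x‖ + ‖redCoeff c' 1 x‖) with hs
      calc B₁ ^ M.card * (A / n * (2 ^ (r - 2) * Q)) * ((6 * n) ^ (r - 1) * s)
          = B₁ ^ M.card * 2 ^ (r - 2) * (6 * n) ^ (r - 1) * Q / n * (A * s) := by ring
        _ ≤ B₁ ^ M.card * 2 ^ (r - 2) * (6 * n) ^ (r - 1) * Q / n *
            (m1' * (n : ℝ) ^ 3 * C 1 ^ 2) :=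
            mul_le_mul_of_nonneg_left hAsum (by positivity)
        _ = B₁ ^ M.card * (2 ^ (r - 2) * 6 ^ (r - 1)) * (n : ℝ) ^ (r + 1) * (PC * mt (ℓ i)) := by
            rw [hPCQ, hmti, mul_pow]
            have : (n : ℝ) ^ (r + 1) = (n : ℝ) ^ (r - 1) * (n : ℝ) ^ 2 := by
              rw [← pow_add]
              congr 1
              omega
            rw [this]
            field_simp
        _ ≤ B₁ ^ M.card * 12 ^ r * (n : ℝ) ^ (r + 1) * (PC * mt (ℓ i)) := by
            have h12 : (2 : ℝ) ^ (r - 2) * 6 ^ (r - 1) ≤ 12 ^ r := by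
              calc (2 : ℝ) ^ (r - 2) * 6 ^ (r - 1) ≤ 2 ^ r * 6 ^ r := by
                    gcongr <;> norm_num
                _ = 12 ^ r := by rw [← mul_pow]; norm_num
            gcongr
    · have hmti : mt (ℓ i) = m (ℓ i) := if_neg hprime
      have key := sum_rooted_le pairWeight_nonneg pairKernel_nonneg pairKernel_le_one
        pairKernel_symm hκ hB0 hM (d := d') (G := G) i (fun j _ => hG0 j) hd'0
        (fun j hj x => by rw [hd', Function.update_of_ne hj]; exact hdG j x)
      have hsum : ∑ x, d' i x ≤ 2 * (n : ℝ) ^ 2 * (m (ℓ i) * C (ℓ i)) := by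
        rw [hd', Function.update_self]
        exact hm.sum_norm_redCoeff_sub_le (hℓ i).1 (hℓ i).2
      set Q := ∏ j ∈ Finset.univ.erase i, C (ℓ j) with hQ
      have hQ0 : 0 ≤ Q := Finset.prod_nonneg fun j _ => hC j
      have hPCQ : PC = C (ℓ i) * Q := by
        rw [hPC, ← Finset.mul_prod_erase _ _ (Finset.mem_univ i)]
      have hmC : 0 ≤ m (ℓ i) * C (ℓ i) :=
        nonneg_of_mul_nonneg_right ((Finset.sum_nonneg fun x _ => hd'0 i x).trans hsum)
          (by positivity)
      have hnn : 0 ≤ PC * mt (ℓ i) := by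
        rw [hPCQ, hmti]
        have := mul_nonneg hmC hQ0
        linarith
      refine ⟨hnn, ?_⟩
      refine (Finset.sum_congr rfl fun e _ => by rw [← hprod]).trans_le (key.trans ?_)
      rw [hG, prod_erase_univ_two_mul i (fun j => C (ℓ j)), ← hQ, Fintype.card_fin]
      calc B₁ ^ M.card * (2 ^ (r - 1) * Q) * ((6 * n) ^ (r - 1) * ∑ x, d' i x)
          ≤ B₁ ^ M.card * (2 ^ (r - 1) * Q) *
            ((6 * n) ^ (r - 1) * (2 * (n : ℝ) ^ 2 * (m (ℓ i) * C (ℓ i)))) := by gcongr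
        _ = B₁ ^ M.card * (2 ^ (r - 1) * 6 ^ (r - 1) * 2) * (n : ℝ) ^ (r + 1) *
            (PC * mt (ℓ i)) := by
            rw [hPCQ, hmti, mul_pow]
            have : (n : ℝ) ^ (r + 1) = (n : ℝ) ^ (r - 1) * (n : ℝ) ^ 2 := by
              rw [← pow_add]
              congr 1
              omega
            rw [this]
            ring
        _ ≤ B₁ ^ M.card * 12 ^ r * (n : ℝ) ^ (r + 1) * (PC * mt (ℓ i)) := by
            have h12 : (2 : ℝ) ^ (r - 1) * 6 ^ (r - 1) * 2 ≤ 12 ^ r := by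
              calc (2 : ℝ) ^ (r - 1) * 6 ^ (r - 1) * 2 = 12 ^ (r - 1) * 2 := by
                    rw [← mul_pow]; norm_num
                _ ≤ 12 ^ (r - 1) * 12 := by gcongr; norm_num
                _ = 12 ^ r := by rw [← pow_succ, ← hr]
            gcongr
  -- the contributions of differences of covariances
  have hedge (p : Fin r × Fin r) (hp : p ∈ M) :
      ∑ e : Fin r → Sym2 (Fin n), (∏ j, d j (e j)) *
        (‖(σ (e p.1) (e p.2) : ℂ) - (σ' (e p.1) (e p.2) : ℂ)‖ *
          ((M.erase p).map fun q => B₁ * pairKernel (e q.1) (e q.2)).prod) ≤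
      B₁ ^ M.card * 12 ^ r * (n : ℝ) ^ (r + 1) * (PC * μ) := by
    have hD (x y : Sym2 (Fin n)) : ‖(σ x y : ℂ) - (σ' x y : ℂ)‖ = |σ x y - σ' x y| := by
      rw [← Complex.ofReal_sub, Complex.norm_real, Real.norm_eq_abs]
    simp_rw [hD]
    have hr : r = r - 1 + 1 := by have := p.1.2; omega
    have hT : (2 : ℝ) * 6 ^ (r - 1) ≤ 6 ^ r := by
      calc (2 : ℝ) * 6 ^ (r - 1) ≤ 6 * 6 ^ (r - 1) := by gcongr; norm_num
        _ = 6 ^ r := by rw [← pow_succ', ← hr]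
    -- A loop gives `2n²` with `r - 1` further vertices at `6n` each, and two distinct ends give
    -- `12n³` with `r - 2`; both equal `2 * 6^(r-1) * n^(r+1)`.
    have key := sum_edge_le pairWeight_nonneg pairKernel_nonneg pairKernel_le_one
      pairKernel_symm hκ hB hM hG0 hd0 hdG (D := fun x y => |σ x y - σ' x y|)
      (fun x y => abs_nonneg _) (T := 6 ^ r * (n : ℝ) ^ (r + 1) * μ) ?_ ?_ hp
    · refine key.trans_eq ?_
      rw [hG, Finset.prod_mul_distrib, Finset.prod_const, Finset.card_univ, Fintype.card_fin, ← hPC]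
      have : (12 : ℝ) ^ r = 2 ^ r * 6 ^ r := by rw [← mul_pow]; norm_num
      rw [this]
      ring
    · rw [Fintype.card_fin]
      calc (6 * (n : ℝ)) ^ (r - 1) * ∑ x, |σ x x - σ' x x| * pairWeight x
          ≤ (6 * (n : ℝ)) ^ (r - 1) * (2 * (n : ℝ) ^ 2 * μ) :=
            mul_le_mul_of_nonneg_left (sum_diag_covDiff_le hμ hn1) (by positivity)
        _ = 2 * 6 ^ (r - 1) * (n : ℝ) ^ (r + 1) * μ := by
            have : (n : ℝ) ^ (r + 1) = (n : ℝ) ^ (r - 1) * (n : ℝ) ^ 2 := by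
              rw [← pow_add]
              congr 1
              omega
            rw [this, mul_pow]
            ring
        _ ≤ 6 ^ r * (n : ℝ) ^ (r + 1) * μ := by gcongr
    · intro hr2
      rw [Fintype.card_fin] at hr2 ⊢
      calc (6 * (n : ℝ)) ^ (r - 2) *
            ∑ x, ∑ y, |σ x y - σ' x y| * (pairWeight x * pairWeight y)
          ≤ (6 * (n : ℝ)) ^ (r - 2) * (12 * (n : ℝ) ^ 3 * μ) :=
            mul_le_mul_of_nonneg_left (sum_covDiff_le hμ hn1) (by positivity)
        _ = 2 * 6 ^ (r - 1) * (n : ℝ) ^ (r + 1) * μ := by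
            have h1 : (n : ℝ) ^ (r + 1) = (n : ℝ) ^ (r - 2) * (n : ℝ) ^ 3 := by
              rw [← pow_add]
              congr 1
              omega
            have h2 : (6 : ℝ) ^ (r - 1) = 6 ^ (r - 2) * 6 := by
              rw [← pow_succ]
              congr 1
              omega
            rw [h1, h2, mul_pow]
            ring
        _ ≤ 6 ^ r * (n : ℝ) ^ (r + 1) * μ := by gcongr
  refine (norm_diagram_sum_sub_le (d := d) (t := fun x y => B₁ * pairKernel x y)
    (fun i x => le_add_of_nonneg_right (norm_nonneg _))
    (fun i x => le_add_of_nonneg_left (norm_nonneg _)) hσ hσ' M).trans ?_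
  set X := ∑ j ∈ Finset.univ.image ℓ, PC * mt j with hX
  -- Nonnegativity of every summand lets the term of one vertex be bounded by the sum over distinct
  -- degrees.
  have hterm0 : ∀ j ∈ Finset.univ.image ℓ, 0 ≤ PC * mt j := by
    intro j hj
    obtain ⟨i, -, rfl⟩ := Finset.mem_image.1 hj
    exact (hlin i).1
  have hX0 : 0 ≤ X := Finset.sum_nonneg hterm0
  set κ := B₁ ^ M.card * 12 ^ r * (n : ℝ) ^ (r + 1) with hκdef
  have hκ0 : 0 ≤ κ := by positivity
  have hsum1 : ∑ i, ∑ e : Fin r → Sym2 (Fin n),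
      ‖redCoeff c (ℓ i) (e i) - redCoeff c' (ℓ i) (e i)‖ *
        (∏ j ∈ Finset.univ.erase i, d j (e j)) *
        (M.map fun p => B₁ * pairKernel (e p.1) (e p.2)).prod ≤ r * (κ * X) := by
    refine (Finset.sum_le_card_nsmul _ _ (κ * X) fun i _ => (hlin i).2.trans ?_).trans_eq
      (by simp)
    exact mul_le_mul_of_nonneg_left (Finset.single_le_sum hterm0
      (Finset.mem_image_of_mem ℓ (Finset.mem_univ i))) hκ0
  have hsum2 : (M.map fun p => ∑ e : Fin r → Sym2 (Fin n), (∏ j, d j (e j)) *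
        (‖(σ (e p.1) (e p.2) : ℂ) - (σ' (e p.1) (e p.2) : ℂ)‖ *
          ((M.erase p).map fun q => B₁ * pairKernel (e q.1) (e q.2)).prod)).sum ≤
      M.card * (κ * (PC * μ)) := by
    refine (Multiset.sum_le_card_nsmul _ (κ * (PC * μ)) fun x hx => ?_).trans_eq (by simp)
    obtain ⟨p, hp, rfl⟩ := Multiset.mem_map.1 hx
    exact hedge p hp
  have hbt : boundTerm C m m1' μ S ℓ = PC * μ + X := by
    rw [boundTerm, mul_add, Finset.mul_sum]
  rw [hbt]
  have h3 : 0 ≤ κ * (PC * μ) := by positivity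
  have h4 : 0 ≤ κ * X := mul_nonneg hκ0 hX0
  have h5 : 0 ≤ (r : ℝ) * (κ * (PC * μ)) := mul_nonneg (Nat.cast_nonneg _) h3
  have h6 : 0 ≤ (M.card : ℝ) * (κ * X) := mul_nonneg (Nat.cast_nonneg _) h4
  refine (add_le_add hsum1 hsum2).trans ?_
  have h7 : B₁ ^ M.card * 12 ^ r * (r + M.card) * (n : ℝ) ^ (r + 1) * (PC * μ + X) =
      r * (κ * X) + M.card * (κ * (PC * μ)) + (r * (κ * (PC * μ)) + M.card * (κ * X)) := by
    rw [hκdef]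
    ring
  rw [h7]
  linarith

end TupleBound

theorem sum_mul_multiset_sum {α E : Type*} [Fintype E] (D : Multiset α) (a : E → ℂ)
    (g : E → α → ℂ) :
    ∑ e, a e * (D.map (g e)).sum = (D.map fun M => ∑ e, a e * g e M).sum := by
  simp_rw [← Multiset.sum_map_mul_left]
  exact Multiset.sum_map_sum_map (Finset.univ : Finset E).val D

end CumDiff
open CumDiff in
theorem theorem2p5 (r L : ℕ) (hr : 1 ≤ r) (hL : 2 ≤ L) (B : ℝ) :
    ∃ K : ℝ, ∀ n : ℕ, 2 ≤ n →
      ∀ {Ω Ω' : Type*} [MeasurableSpace Ω] [MeasurableSpace Ω']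
        (P : Measure Ω) [IsProbabilityMeasure P] (P' : Measure Ω') [IsProbabilityMeasure P']
        (Y : Sym2 (Fin n) → Ω → ℝ) (Y' : Sym2 (Fin n) → Ω' → ℝ)
        (c c' : ℕ → Sym2 (Fin n) → ℂ) (C m : ℕ → ℝ) (m1' μ : ℝ),
        IsGaussianFamily P B Y → IsGaussianFamily P' B Y' →
        CoeffBounds L C c → CoeffBounds L C c' →
        CovDiffBound μ (fun e f => cov[Y e, Y f; P]) (fun e f => cov[Y' e, Y' f; P']) →
        CoeffDiffBounds L C m m1' c c' →
        -- `S` is the set of tuples in which the option to use `μ'₁` instead of `μ₁` is taken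
        ∀ S : Finset (Fin r → ℕ),
          (∀ ℓ ∈ S, 2 ≤ (Finset.univ.filter fun i => ℓ i = 1).card) →
          ‖cumulant P r (polyFunctional L c Y) - cumulant P' r (polyFunctional L c' Y')‖
            ≤ K * (n : ℝ) ^ (r + 1) *
              (degreeTuples r L).sup' (degreeTuples_nonempty r hL)
                (boundTerm C m m1' μ S) := by
  set k : Multiset (Fin r × Fin r) → ℝ :=
    fun M => max 1 B ^ M.card * 12 ^ r * (r + M.card) with hk
  -- The diagrams depend only on the degrees, so this constant depends only on `r`, `L` and `B`.
  refine ⟨∑ ℓ ∈ Fintype.piFinset fun _ : Fin r => Finset.Icc 1 L, ((diagrams ℓ).map k).sum, ?_⟩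
  intro n hn Ω Ω' _ _ P _ P' _ Y Y' c c' C m m1' μ hY hY' hc hc' hμ hm S hS
  set s := (degreeTuples r L).sup' (degreeTuples_nonempty r hL) (boundTerm C m m1' μ S) with hs
  rw [cumulant_polyFunctional hY hr hL, cumulant_polyFunctional hY' hr hL,
    ← Finset.sum_sub_distrib, Finset.sum_mul, Finset.sum_mul]
  refine (norm_sum_le _ _).trans (Finset.sum_le_sum fun ℓ hℓ => ?_)
  have hℓ' : ∀ i, 1 ≤ ℓ i ∧ ℓ i ≤ L := fun i => Finset.mem_Icc.1 (Fintype.mem_piFinset.1 hℓ i)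
  rw [sum_mul_multiset_sum, sum_mul_multiset_sum, ← Multiset.sum_map_sub, mul_assoc,
    ← Multiset.sum_map_mul_right]
  refine norm_multiset_sum_map_le _ fun M hM => ?_
  -- A diagram exists only for an even degree sum. Tuples with odd sum contribute zero to both
  -- sides, so the sign of `s` is never needed.
  have hmem : ℓ ∈ degreeTuples r L := Finset.mem_filter.2 ⟨hℓ, even_of_mem_diagrams hM⟩
  refine (norm_diagram_sum_sub_le_boundTerm hn hc hc' (le_max_left 1 B) hY.norm_cov_le
    hY'.norm_cov_le hμ hm hS hℓ' (isConn_of_mem_connectedDiagrams hM)).trans ?_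
  rw [mul_assoc]
  have h1 : boundTerm C m m1' μ S ℓ ≤ s := Finset.le_sup' _ hmem
  have h2 : 0 ≤ k M := by positivity
  exact mul_le_mul_of_nonneg_left (mul_le_mul_of_nonneg_left h1 (by positivity)) h2
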